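/- Let $R=\bigoplus_{n\ge 0}R_n$ be a commutative graded ring which is a finitely generated standard graded algebra over the noetherian ring $R_0$ (i.e. $R$ is generated by $R_1$ as an $R_0$-algebra), let $R_+=\bigoplus_{n>0}R_n$, and let $M$ be a finitely generated $\mathbb Z$-graded $R$-module. For a graded module $H$ put $a(H)=\sup\{n\mid H_n\neq 0\}$, with $a(H)=-\infty$ if $H=0$. Let $H^i_{R_+}$ denote the $i$-th right derived functor, on graded $R$-modules, of $\Gamma_{R_+}(M)=\{e\in M\mid R_n e=0 \text{ for } n\gg 0\}$, let $a_i(M)=a(H^i_{R_+}(M))$, and for $t\ge 0$ let $$\operatorname{reg}_t(M)=\max\{a_i(M)+i\mid i\le t\},\qquad a^*_t(M)=\max\{a_i(M)\mid i\le t\}.$$ A sequence $z_1,\dots,z_s$ of homogeneous elements of $R$ is called $M$-filter-regular if, with $Q_0=0$ and $Q_i=(z_1,\dots,z_i)$, one has $\big((Q_iM:z_{i+1})/Q_iM\big)_n=0$ for $n\gg0$ and every $i=0,\dots,s-1$; here $Q_iM:z=\{m\in M\mid zm\in Q_iM\}$ and $Q_iM:R_+=\{m\in M\mid R_+m\subseteq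 Q_iM\}$. For a sequence with $s\ge 1$ put $$a(z_1,\dots,z_s;M)=\max_{0\le i\le s-1} a\big((Q_iM:z_{i+1})/Q_iM\big),\qquad s(z_1,\dots,z_s;M)=\max_{0\le i\le s-1}\Big(a\big((Q_iM:z_{i+1})/Q_iM\big)-i\Big).$$ Let $t\ge 0$. (1) If $z_1,\dots,z_{t+1}$ is an $M$-filter-regular sequence of linear forms (elements of $R_1$), then $$\operatorname{reg}_t(M)=a(z_1,\dots,z_{t+1};M)\quad\text{and}\quad a^*_t(M)=s(z_1,\dots,z_{t+1};M).$$ (2) If $z_1,\dots,z_t$ is an $M$-filter-regular sequence of linear forms, then $$\operatorname{reg}_t(M)=\max_{0\le i\le t} a\big((Q_iM:R_+)/Q_iM\big)\quad\text{and}\quad a^*_t(M)=\max_{0\le i\le t}\Big(a\big((Q_iM:R_+)/Q_iM\big)-i\Big).$$ -/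

import Mathlib

open CategoryTheory CategoryTheory.Limits

universe v u

section GradedGroups

variable {X : Type*} [AddCommGroup X] {𝒳 : ℤ → AddSubgroup X}

/-- The homogeneous component of degree `n` with respect to an internal direct sum. -/
noncomputable def gradedProj (h : DirectSum.IsInternal 𝒳) (n : ℤ) : X →+ X :=
  letI := h.chooseDecomposition
  (𝒳 n).subtype.comp ((DFinsupp.evalAddMonoidHom n).comp
    (DirectSum.decomposeAddEquiv 𝒳).toAddMonoidHom)

lemma gradedProj_mem (h : DirectSum.IsInternal 𝒳) (n : ℤ) (x : X) : gradedProj h n x ∈ 𝒳 n :=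
  SetLike.coe_mem _

lemma gradedProj_same (h : DirectSum.IsInternal 𝒳) {n : ℤ} {x : X} (hx : x ∈ 𝒳 n) :
    gradedProj h n x = x := by
  let := h.chooseDecomposition
  exact DirectSum.decompose_of_mem_same 𝒳 hx

lemma gradedProj_ne (h : DirectSum.IsInternal 𝒳) {n k : ℤ} {x : X} (hx : x ∈ 𝒳 n)
    (hk : n ≠ k) : gradedProj h k x = 0 := by
  let := h.chooseDecomposition
  exact DirectSum.decompose_of_mem_ne 𝒳 hx hk

lemma exists_sum_gradedProj (h : DirectSum.IsInternal 𝒳) (x : X) :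
    ∃ s : Finset ℤ, x = ∑ n ∈ s, gradedProj h n x := by
  classical
  let := h.chooseDecomposition
  exact ⟨_, (DirectSum.sum_support_decompose 𝒳 x).symm⟩

/-- Componentwise criterion for an internal direct sum. -/
lemma isInternal_of_proj (p : ℤ → X →+ X) (hmem : ∀ n x, p n x ∈ 𝒳 n)
    (hne : ∀ n k x, x ∈ 𝒳 n → n ≠ k → p k x = 0)
    (hsum : ∀ x, ∃ s : Finset ℤ, x = ∑ n ∈ s, p n x) : DirectSum.IsInternal 𝒳 := by
  classical
  have hsame : ∀ n x, x ∈ 𝒳 n → p n x = x := by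
    intro n x hx
    obtain ⟨s, hs⟩ := hsum x
    by_cases hn : n ∈ s
    · rw [Finset.sum_eq_single_of_mem n hn (fun k _ hk => hne n k x hx hk.symm)] at hs
      exact hs.symm
    · rw [Finset.sum_eq_zero (fun k hk => hne n k x hx (fun e => hn (e ▸ hk)))] at hs
      simp [hs]
  have key : ∀ (k : ℤ) (y : DirectSum ℤ fun n => 𝒳 n),
      p k (DirectSum.coeAddMonoidHom 𝒳 y) = y k := by
    intro k y
    induction y using DirectSum.induction_on with
    | zero => simp
    | of n x =>
      rw [DirectSum.coeAddMonoidHom_of]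
      by_cases hk : n = k
      · subst hk; rw [DirectSum.of_eq_same]; exact hsame _ _ x.2
      · rw [DirectSum.of_eq_of_ne _ _ _ (Ne.symm hk)]; exact hne n k _ x.2 hk
    | add a b ha hb => simp [ha, hb]
  constructor
  · intro y z hyz
    ext k
    rw [← key, ← key]
    exact congrArg _ hyz
  · intro x
    obtain ⟨s, hs⟩ := hsum x
    refine ⟨∑ n ∈ s, DirectSum.of (fun n => 𝒳 n) n ⟨p n x, hmem n x⟩, ?_⟩
    conv_rhs => rw [hs]
    simp

end GradedGroups

/-- A `ℤ`-graded module over the graded ring `R = ⨁ 𝒜 n`: an `R`-module which is the internal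
direct sum of subgroups `deg n`, `n : ℤ`, such that `𝒜 i • deg j ⊆ deg (i + j)`. -/
structure GrMod {R : Type u} [CommRing R] (𝒜 : ℕ → AddSubgroup R) : Type (max u (v + 1)) where
  carrier : Type v
  [addCommGroup : AddCommGroup carrier]
  [module : Module R carrier]
  deg : ℤ → AddSubgroup carrier
  isInternal : DirectSum.IsInternal deg
  smul_mem : ∀ (i : ℕ) (j : ℤ) (r : R) (m : carrier), r ∈ 𝒜 i → m ∈ deg j →
    r • m ∈ deg (i + j)

namespace GrMod

variable {R : Type u} [CommRing R] {𝒜 : ℕ → AddSubgroup R}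

instance : CoeSort (GrMod.{v} 𝒜) (Type v) := ⟨GrMod.carrier⟩

attribute [instance] GrMod.addCommGroup GrMod.module

/-- Morphisms of graded modules: `R`-linear maps of degree zero. -/
@[ext]
structure Hom (M N : GrMod.{v} 𝒜) : Type v where
  lin : M →ₗ[R] N
  map_deg : ∀ n m, m ∈ M.deg n → lin m ∈ N.deg n

/-- The category of graded `R`-modules. -/
instance : Category (GrMod.{v} 𝒜) where
  Hom M N := Hom M N
  id M := ⟨LinearMap.id, fun _ _ h => h⟩
  comp f g := ⟨g.lin.comp f.lin, fun n m h => g.map_deg n _ (f.map_deg n m h)⟩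

variable {M N P : GrMod.{v} 𝒜}

lemma hom_ext {f g : M ⟶ N} (h : ∀ x, f.lin x = g.lin x) : f = g :=
  Hom.ext (LinearMap.ext h)

@[simp] lemma id_lin (M : GrMod.{v} 𝒜) : (𝟙 M : M ⟶ M).lin = LinearMap.id := rfl
@[simp] lemma comp_lin (f : M ⟶ N) (g : N ⟶ P) : (f ≫ g).lin = g.lin.comp f.lin := rfl

instance : Zero (M ⟶ N) := ⟨⟨0, fun n _ _ => (N.deg n).zero_mem⟩⟩
instance : Add (M ⟶ N) := ⟨fun f g =>
  ⟨f.lin + g.lin, fun n m h => (N.deg n).add_mem (f.map_deg n m h) (g.map_deg n m h)⟩⟩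
instance : Neg (M ⟶ N) := ⟨fun f => ⟨-f.lin, fun n m h => (N.deg n).neg_mem (f.map_deg n m h)⟩⟩
instance : Sub (M ⟶ N) := ⟨fun f g =>
  ⟨f.lin - g.lin, fun n m h => (N.deg n).sub_mem (f.map_deg n m h) (g.map_deg n m h)⟩⟩
instance : SMul ℕ (M ⟶ N) := ⟨fun k f =>
  ⟨k • f.lin, fun n m h => (N.deg n).nsmul_mem (f.map_deg n m h) k⟩⟩
instance : SMul ℤ (M ⟶ N) := ⟨fun k f =>
  ⟨k • f.lin, fun n m h => (N.deg n).zsmul_mem (f.map_deg n m h) k⟩⟩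

lemma lin_injective : Function.Injective (fun f : M ⟶ N => f.lin) := fun _ _ h => Hom.ext h

instance : AddCommGroup (M ⟶ N) :=
  Function.Injective.addCommGroup (fun f : M ⟶ N => f.lin) lin_injective rfl
    (fun _ _ => rfl) (fun _ => rfl) (fun _ _ => rfl) (fun _ _ => rfl) (fun _ _ => rfl)

@[simp] lemma zero_lin : (0 : M ⟶ N).lin = 0 := rfl
@[simp] lemma add_lin (f g : M ⟶ N) : (f + g).lin = f.lin + g.lin := rfl

instance : Preadditive (GrMod.{v} 𝒜) where
  add_comp _ _ _ f g h := hom_ext fun x => by simp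
  comp_add _ _ _ f g h := hom_ext fun x => by simp

/-- The homogeneous component of degree `n`. -/
noncomputable def proj (M : GrMod.{v} 𝒜) (n : ℤ) : M →+ M := gradedProj M.isInternal n

lemma map_proj (f : M ⟶ N) (n : ℤ) (x : M) : f.lin (M.proj n x) = N.proj n (f.lin x) := by
  classical
  obtain ⟨s, hs⟩ := exists_sum_gradedProj M.isInternal x
  have h1 : ∀ k, f.lin (M.proj k x) ∈ N.deg k := fun k => f.map_deg k _ (gradedProj_mem _ _ _)
  have h2 : ∀ y : M, ∀ k, y ∈ M.deg k → f.lin (M.proj n y) = N.proj n (f.lin y) := by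
    intro y k hy
    by_cases hk : k = n
    · subst hk
      rw [proj, proj, gradedProj_same _ hy, gradedProj_same _ (f.map_deg _ _ hy)]
    · rw [proj, proj, gradedProj_ne _ hy hk, gradedProj_ne _ (f.map_deg _ _ hy) hk, map_zero]
  rw [hs]
  simp only [map_sum]
  exact Finset.sum_congr rfl fun k _ => h2 _ k (gradedProj_mem _ _ _)

lemma mem_deg_of_injective (f : M ⟶ N) (hf : Function.Injective f.lin) {n : ℤ} {x : M}
    (hx : f.lin x ∈ N.deg n) : x ∈ M.deg n := by
  have : M.proj n x = x := hf (by rw [map_proj]; exact gradedProj_same _ hx)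
  rw [← this]; exact gradedProj_mem _ _ _

/-- A homogeneous submodule as a graded module. -/
def sub (M : GrMod.{v} 𝒜) (K : Submodule R M) (hK : ∀ n, ∀ x ∈ K, M.proj n x ∈ K) :
    GrMod.{v} 𝒜 where
  carrier := K
  deg n := (M.deg n).comap K.subtype.toAddMonoidHom
  isInternal := isInternal_of_proj
    (fun n => ((M.proj n).comp K.subtype.toAddMonoidHom).codRestrict K (fun x => hK n x x.2))
    (fun n x => gradedProj_mem M.isInternal n (x : M))
    (fun n k x hx hk => Subtype.ext (gradedProj_ne M.isInternal hx hk))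
    (fun x => by
      obtain ⟨s, hs⟩ := exists_sum_gradedProj M.isInternal (x : M)
      refine ⟨s, Subtype.ext ?_⟩
      rw [hs.trans rfl]
      simp [proj, ← hs])
  smul_mem i j r m hr hm := M.smul_mem i j r m hr hm

/-- The inclusion of a homogeneous submodule. -/
def subι (M : GrMod.{v} 𝒜) (K : Submodule R M) (hK : ∀ n, ∀ x ∈ K, M.proj n x ∈ K) :
    M.sub K hK ⟶ M :=
  ⟨K.subtype, fun _ _ h => h⟩

/-- The quotient by a homogeneous submodule as a graded module. -/
def quot (M : GrMod.{v} 𝒜) (K : Submodule R M) (hK : ∀ n, ∀ x ∈ K, M.proj n x ∈ K) :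
    GrMod.{v} 𝒜 where
  carrier := M ⧸ K
  deg n := (M.deg n).map K.mkQ.toAddMonoidHom
  isInternal := by
    let p : ℤ → (M ⧸ K) →+ (M ⧸ K) := fun n =>
      QuotientAddGroup.map K.toAddSubgroup K.toAddSubgroup (M.proj n) (fun x hx => hK n x hx)
    have hp : ∀ n (x : M), p n (K.mkQ x) = K.mkQ (M.proj n x) := fun n x => rfl
    refine isInternal_of_proj p ?_ ?_ ?_
    · intro n x
      obtain ⟨x, rfl⟩ := K.mkQ_surjective x
      exact ⟨M.proj n x, gradedProj_mem _ _ _, (hp n x).symm⟩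
    · rintro n k _ ⟨x, hx, rfl⟩ hk
      refine (hp k x).trans ?_
      rw [proj, gradedProj_ne _ hx hk, map_zero]
    · intro x
      obtain ⟨x, rfl⟩ := K.mkQ_surjective x
      obtain ⟨s, hs⟩ := exists_sum_gradedProj M.isInternal x
      refine ⟨s, ?_⟩
      simp only [hp]
      rw [← map_sum]
      exact congrArg _ hs
  smul_mem := by
    rintro i j r _ hr ⟨x, hx, rfl⟩
    exact ⟨r • x, M.smul_mem i j r x hr hx, rfl⟩

/-- The projection onto the quotient by a homogeneous submodule. -/
def quotπ (M : GrMod.{v} 𝒜) (K : Submodule R M) (hK : ∀ n, ∀ x ∈ K, M.proj n x ∈ K) :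
    M ⟶ M.quot K hK :=
  ⟨K.mkQ, fun _ x h => ⟨x, h, rfl⟩⟩

lemma ker_homog (f : M ⟶ N) (n : ℤ) (x : M) (hx : x ∈ LinearMap.ker f.lin) :
    M.proj n x ∈ LinearMap.ker f.lin := by
  rw [LinearMap.mem_ker] at hx ⊢
  rw [map_proj, hx, map_zero]

lemma range_homog (f : M ⟶ N) (n : ℤ) (x : N) (hx : x ∈ LinearMap.range f.lin) :
    N.proj n x ∈ LinearMap.range f.lin := by
  obtain ⟨y, rfl⟩ := hx
  exact ⟨M.proj n y, map_proj f n y⟩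

lemma subι_comp (f : M ⟶ N) : M.subι (LinearMap.ker f.lin) (ker_homog f) ≫ f = 0 :=
  hom_ext fun x => x.2

lemma comp_quotπ (f : M ⟶ N) : f ≫ N.quotπ (LinearMap.range f.lin) (range_homog f) = 0 :=
  hom_ext fun x => (Submodule.Quotient.mk_eq_zero _).2 ⟨x, rfl⟩

/-- The kernel of a morphism as a fork. -/
def kernelFork (f : M ⟶ N) : KernelFork f :=
  KernelFork.ofι (M.subι (LinearMap.ker f.lin) (ker_homog f)) (subι_comp f)

/-- The module-theoretic kernel is the categorical kernel. -/
def kernelForkIsLimit (f : M ⟶ N) : IsLimit (kernelFork f) :=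
  KernelFork.IsLimit.ofι _ (subι_comp f)
    (fun {W} g hg => ⟨g.lin.codRestrict _ fun x => by
      have := congrArg (fun h : W ⟶ N => h.lin x) hg
      exact this, fun n m h => g.map_deg n m h⟩)
    (fun _ _ => rfl)
    (fun {W} g hg m hm => hom_ext fun x => Subtype.ext (by
      have := congrArg (fun h : W ⟶ M => h.lin x) hm
      exact this))

/-- The cokernel of a morphism as a cofork. -/
def cokernelCofork (f : M ⟶ N) : CokernelCofork f :=
  CokernelCofork.ofπ (N.quotπ (LinearMap.range f.lin) (range_homog f)) (comp_quotπ f)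

/-- The module-theoretic cokernel is the categorical cokernel. -/
def cokernelCoforkIsColimit (f : M ⟶ N) : IsColimit (cokernelCofork f) :=
  CokernelCofork.IsColimit.ofπ _ (comp_quotπ f)
    (fun {W} g hg => ⟨(LinearMap.range f.lin).liftQ g.lin (by
        rintro _ ⟨x, rfl⟩
        have := congrArg (fun h : M ⟶ W => h.lin x) hg
        exact this), by
      rintro n _ ⟨x, hx, rfl⟩
      exact g.map_deg n x hx⟩)
    (fun _ _ => hom_ext fun _ => rfl)
    (fun {W} g hg m hm => hom_ext fun x => by
      obtain ⟨x, rfl⟩ := Submodule.mkQ_surjective _ x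
      have := congrArg (fun h : N ⟶ W => h.lin x) hm
      exact this)

instance : HasKernels (GrMod.{v} 𝒜) := ⟨fun f => HasLimit.mk ⟨_, kernelForkIsLimit f⟩⟩
instance : HasCokernels (GrMod.{v} 𝒜) := ⟨fun f => HasColimit.mk ⟨_, cokernelCoforkIsColimit f⟩⟩

lemma injective_of_mono (f : M ⟶ N) [Mono f] : Function.Injective f.lin := by
  rw [← LinearMap.ker_eq_bot, LinearMap.ker_eq_bot']
  intro x hx
  have h : M.subι (LinearMap.ker f.lin) (ker_homog f) = 0 :=
    (cancel_mono f).1 ((subι_comp f).trans zero_comp.symm)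
  exact congrArg (fun h : M.sub (LinearMap.ker f.lin) (ker_homog f) ⟶ M => h.lin ⟨x, hx⟩) h

lemma mono_of_injective (f : M ⟶ N) (hf : Function.Injective f.lin) : Mono f :=
  ⟨fun {W} _ _ e => hom_ext fun x => hf (congrArg (fun k : W ⟶ N => k.lin x) e)⟩

lemma surjective_of_epi (f : M ⟶ N) [Epi f] : Function.Surjective f.lin := by
  intro x
  have h : N.quotπ (LinearMap.range f.lin) (range_homog f) = 0 :=
    (cancel_epi f).1 ((comp_quotπ f).trans comp_zero.symm)
  have h' := congrArg (fun h : N ⟶ N.quot (LinearMap.range f.lin) (range_homog f) => h.lin x) h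
  exact (Submodule.Quotient.mk_eq_zero _).1 h'

/-- Every monomorphism is the kernel of its cokernel. -/
noncomputable def normalMono (f : M ⟶ N) (hf : Function.Injective f.lin) : NormalMono f where
  Z := N.quot (LinearMap.range f.lin) (range_homog f)
  g := N.quotπ (LinearMap.range f.lin) (range_homog f)
  w := comp_quotπ f
  isLimit := by
    have key : ∀ {W : GrMod.{v} 𝒜} (g : W ⟶ N)
        (_ : g ≫ N.quotπ (LinearMap.range f.lin) (range_homog f) = 0) (x : W),
        g.lin x ∈ LinearMap.range f.lin := fun {W} g hg x =>
      (Submodule.Quotient.mk_eq_zero _).1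
        (congrArg (fun h : W ⟶ N.quot (LinearMap.range f.lin) (range_homog f) => h.lin x) hg)
    have key2 : ∀ {W : GrMod.{v} 𝒜} (g : W ⟶ N)
        (hg : g ≫ N.quotπ (LinearMap.range f.lin) (range_homog f) = 0) (x : W),
        f.lin ((LinearEquiv.ofInjective f.lin hf).symm ⟨g.lin x, key g hg x⟩) = g.lin x := by
      intro W g hg x
      have := (LinearEquiv.ofInjective f.lin hf).apply_symm_apply ⟨g.lin x, key g hg x⟩
      exact congrArg Subtype.val this
    exact KernelFork.IsLimit.ofι _ _
      (fun {W} g hg => ⟨(LinearEquiv.ofInjective f.lin hf).symm.toLinearMap.comp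
          (g.lin.codRestrict _ (key g hg)), fun n m hm =>
            mem_deg_of_injective f hf (by
              have := g.map_deg n m hm
              rw [← key2 g hg m] at this
              exact this)⟩)
      (fun {W} g hg => hom_ext fun x => key2 g hg x)
      (fun {W} g hg m hm => hom_ext fun x => hf (by
        refine Eq.trans ?_ (key2 g hg x).symm
        exact congrArg (fun h : W ⟶ N => h.lin x) hm))

/-- Every epimorphism is the cokernel of its kernel. -/
noncomputable def normalEpi (f : M ⟶ N) (hf : Function.Surjective f.lin) : NormalEpi f where
  W := M.sub (LinearMap.ker f.lin) (ker_homog f)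
  g := M.subι (LinearMap.ker f.lin) (ker_homog f)
  w := subι_comp f
  isColimit := by
    have key : ∀ {W : GrMod.{v} 𝒜} (g : M ⟶ W)
        (_ : M.subι (LinearMap.ker f.lin) (ker_homog f) ≫ g = 0),
        LinearMap.ker f.lin ≤ LinearMap.ker g.lin := fun {W} g hg x hx =>
      congrArg (fun h : M.sub (LinearMap.ker f.lin) (ker_homog f) ⟶ W => h.lin ⟨x, hx⟩) hg
    have key2 : ∀ {W : GrMod.{v} 𝒜} (g : M ⟶ W)
        (hg : M.subι (LinearMap.ker f.lin) (ker_homog f) ≫ g = 0) (x : M),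
        (LinearMap.ker f.lin).liftQ g.lin (key g hg)
          ((f.lin.quotKerEquivOfSurjective hf).symm (f.lin x)) = g.lin x := by
      intro W g hg x
      have : (f.lin.quotKerEquivOfSurjective hf).symm (f.lin x) = Submodule.Quotient.mk x := by
        rw [LinearEquiv.symm_apply_eq]; rfl
      rw [this]; rfl
    exact CokernelCofork.IsColimit.ofπ _ _
      (fun {W} g hg => ⟨((LinearMap.ker f.lin).liftQ g.lin (key g hg)).comp
          (f.lin.quotKerEquivOfSurjective hf).symm.toLinearMap, fun n y hy => by
            obtain ⟨x, rfl⟩ := hf y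
            have h1 : f.lin (M.proj n x) = f.lin x := by
              rw [map_proj]; exact gradedProj_same _ hy
            rw [← h1]
            refine Eq.subst (motive := (· ∈ W.deg n)) (key2 g hg _).symm
              (g.map_deg n _ (gradedProj_mem _ _ _))⟩)
      (fun {W} g hg => hom_ext fun x => key2 g hg x)
      (fun {W} g hg m hm => hom_ext fun y => by
        obtain ⟨x, rfl⟩ := hf y
        refine Eq.trans ?_ (key2 g hg x).symm
        exact congrArg (fun h : M ⟶ W => h.lin x) hm)

/-- The direct sum of two graded modules. -/
def prod (M N : GrMod.{v} 𝒜) : GrMod.{v} 𝒜 where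
  carrier := M × N
  deg n := (M.deg n).prod (N.deg n)
  isInternal := isInternal_of_proj (fun n => (M.proj n).prodMap (N.proj n))
    (fun n x => ⟨gradedProj_mem _ _ _, gradedProj_mem _ _ _⟩)
    (fun n k x hx hk => Prod.ext (gradedProj_ne _ hx.1 hk) (gradedProj_ne _ hx.2 hk))
    (fun x => by
      classical
      have aux : ∀ (L : GrMod.{v} 𝒜) (y : L) (s t : Finset ℤ), s ⊆ t →
          y = ∑ n ∈ s, L.proj n y → y = ∑ n ∈ t, L.proj n y := by
        intro L y s t hst hs
        rw [← Finset.sum_subset hst]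
        · exact hs
        · intro k _ hk
          rw [hs, map_sum]
          exact Finset.sum_eq_zero fun j hj =>
            gradedProj_ne L.isInternal (gradedProj_mem _ _ _) (fun e => hk (e ▸ hj))
      obtain ⟨s, hs⟩ := exists_sum_gradedProj M.isInternal x.1
      obtain ⟨t, ht⟩ := exists_sum_gradedProj N.isInternal x.2
      refine ⟨s ∪ t, Prod.ext ?_ ?_⟩
      · rw [Prod.fst_sum]
        exact aux M x.1 s _ Finset.subset_union_left hs
      · rw [Prod.snd_sum]
        exact aux N x.2 t _ Finset.subset_union_right ht)
  smul_mem i j r m hr hm := ⟨M.smul_mem i j r _ hr hm.1, N.smul_mem i j r _ hr hm.2⟩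

instance : HasBinaryBiproducts (GrMod.{v} 𝒜) where
  has_binary_biproduct M N := hasBinaryBiproduct_of_total
    { pt := prod M N
      fst := ⟨LinearMap.fst R M N, fun _ _ h => h.1⟩
      snd := ⟨LinearMap.snd R M N, fun _ _ h => h.2⟩
      inl := ⟨LinearMap.inl R M N, fun n _ h => ⟨h, (N.deg n).zero_mem⟩⟩
      inr := ⟨LinearMap.inr R M N, fun n _ h => ⟨(M.deg n).zero_mem, h⟩⟩
      inl_fst := rfl
      inl_snd := rfl
      inr_fst := rfl
      inr_snd := rfl }
    (hom_ext fun x => Prod.ext (add_zero x.1) (zero_add x.2))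

/-- The zero graded module. -/
def zero (𝒜 : ℕ → AddSubgroup R) : GrMod.{v} 𝒜 where
  carrier := PUnit
  deg _ := ⊤
  isInternal := isInternal_of_proj (fun _ => 0) (fun _ _ => trivial) (fun _ _ _ _ _ => rfl)
    (fun _ => ⟨∅, rfl⟩)
  smul_mem _ _ _ _ _ _ := trivial

instance : HasZeroObject (GrMod.{v} 𝒜) where
  zero := ⟨zero 𝒜, (IsZero.iff_id_eq_zero _).2 (hom_ext fun _ => rfl)⟩

instance : HasFiniteProducts (GrMod.{v} 𝒜) :=
  have : HasTerminal (GrMod.{v} 𝒜) := inferInstance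
  hasFiniteProducts_of_has_binary_and_terminal

noncomputable instance : Abelian (GrMod.{v} 𝒜) where
  normalMonoOfMono f _ := ⟨normalMono f (injective_of_mono f)⟩
  normalEpiOfEpi f _ := ⟨normalEpi f (surjective_of_epi f)⟩

section EnoughInjectives

lemma induction_on {motive : M → Prop} (x : M) (zero : motive 0)
    (homog : ∀ n x, x ∈ M.deg n → motive x) (add : ∀ x y, motive x → motive y → motive (x + y)) :
    motive x := by
  classical
  obtain ⟨s, hs⟩ := exists_sum_gradedProj M.isInternal x
  rw [hs]
  exact Finset.sum_induction _ motive (fun a b => add a b) zero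
    (fun n _ => homog n _ (gradedProj_mem _ _ _))

lemma hom_ext_homog {f g : M ⟶ N} (h : ∀ n x, x ∈ M.deg n → f.lin x = g.lin x) : f = g :=
  hom_ext fun x => by
    induction x using induction_on with
    | zero => simp
    | add x y hx hy => simp only [map_add, hx, hy]
    | homog n x hx => exact h n x hx

/-- The underlying group of `J[T, T⁻¹]`. -/
def Laurent (_ : ℕ → AddSubgroup R) (J : Type v) [AddCommGroup J] : Type v := ℤ →₀ J

variable (J : Type v) [AddCommGroup J]

noncomputable instance : AddCommGroup (Laurent 𝒜 J) := inferInstanceAs (AddCommGroup (ℤ →₀ J))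

/-- The monomial `x T ^ n`. -/
noncomputable def mono (𝒜 : ℕ → AddSubgroup R) {J : Type v} [AddCommGroup J] (n : ℤ) :
    J →+ Laurent 𝒜 J :=
  Finsupp.singleAddHom n

/-- The coefficient of `T ^ n`. -/
noncomputable def coeff (𝒜 : ℕ → AddSubgroup R) {J : Type v} [AddCommGroup J] (n : ℤ) :
    Laurent 𝒜 J →+ J :=
  Finsupp.applyAddHom n

variable {J}

lemma coeff_mono_same (n : ℤ) (x : J) : coeff 𝒜 n (mono 𝒜 n x) = x := Finsupp.single_eq_same

lemma coeff_mono_ne {n k : ℤ} (h : n ≠ k) (x : J) : coeff 𝒜 k (mono 𝒜 n x) = 0 :=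
  Finsupp.single_eq_of_ne (Ne.symm h)

/-- Additive maps out of `J[T, T⁻¹]`. -/
noncomputable def laurentLift {A : Type*} [AddCommGroup A] (f : ℤ → J →+ A) : Laurent 𝒜 J →+ A :=
  Finsupp.liftAddHom f

lemma laurentLift_mono {A : Type*} [AddCommGroup A] (f : ℤ → J →+ A) (n : ℤ) (x : J) :
    laurentLift (𝒜 := 𝒜) f (mono 𝒜 n x) = f n x :=
  Finsupp.liftAddHom_apply_single f n x

lemma laurent_ext {A : Type*} [AddCommGroup A] {f g : Laurent 𝒜 J →+ A}
    (h : ∀ n x, f (mono 𝒜 n x) = g (mono 𝒜 n x)) : f = g :=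
  Finsupp.addHom_ext h

variable [Module R J]

variable (𝒜 J) in
/-- A homogeneous element `r` of degree `i` acts on `J[T, T⁻¹]` as multiplication by `r T ^ i`. -/
noncomputable def laurentActHomog (i : ℕ) : 𝒜 i →+ AddMonoid.End (Laurent 𝒜 J) :=
  AddMonoidHom.mk' (fun a => (laurentLift fun n =>
      (mono 𝒜 ((i : ℤ) + n)).comp (DistribSMul.toAddMonoidHom J (a : R)) :
        Laurent 𝒜 J →+ Laurent 𝒜 J))
    (fun a b => laurent_ext fun n x => by
      refine (laurentLift_mono _ _ _).trans (Eq.symm ?_)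
      refine (congrArg₂ (fun y z : Laurent 𝒜 J => y + z) (laurentLift_mono _ _ _)
        (laurentLift_mono _ _ _)).trans ?_
      simp [add_smul])

lemma laurentActHomog_mono (i : ℕ) (a : 𝒜 i) (n : ℤ) (x : J) :
    laurentActHomog 𝒜 J i a (mono 𝒜 n x) = mono 𝒜 (i + n) ((a : R) • x) :=
  laurentLift_mono _ _ _

/-- The additive map `x ↦ ∑ g (xₙ) T ^ n`. -/
noncomputable def toLaurentAux (g : M →ₗ[R] J) : M →+ Laurent 𝒜 J :=
  letI := M.isInternal.chooseDecomposition
  (DirectSum.toAddMonoid fun n =>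
    (mono 𝒜 n).comp (g.toAddMonoidHom.comp (M.deg n).subtype)).comp
    (DirectSum.decomposeAddEquiv M.deg).toAddMonoidHom

lemma toLaurentAux_apply (g : M →ₗ[R] J) {n : ℤ} {x : M} (hx : x ∈ M.deg n) :
    toLaurentAux g x = mono 𝒜 n (g x) := by
  let := M.isInternal.chooseDecomposition
  have : DirectSum.decomposeAddEquiv M.deg x = DirectSum.of (fun i => M.deg i) n ⟨x, hx⟩ :=
    DirectSum.decompose_of_mem _ hx
  refine (congrArg (DirectSum.toAddMonoid fun n =>
    (mono 𝒜 n).comp (g.toAddMonoidHom.comp (M.deg n).subtype)) this).trans ?_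
  rw [DirectSum.toAddMonoid_of]
  rfl

variable [GradedRing 𝒜]

lemma laurentActHomog_one :
    laurentActHomog 𝒜 J 0 ⟨1, SetLike.GradedOne.one_mem⟩ = 1 :=
  laurent_ext fun n x => by
    refine (laurentActHomog_mono 0 _ n x).trans ?_
    simp only [Nat.cast_zero, zero_add, one_smul]
    rfl

lemma laurentActHomog_mul {i j : ℕ} (a : 𝒜 i) (b : 𝒜 j) :
    laurentActHomog 𝒜 J (i + j) ⟨a * b, SetLike.GradedMul.mul_mem a.2 b.2⟩ =
      laurentActHomog 𝒜 J i a * laurentActHomog 𝒜 J j b :=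
  laurent_ext fun n x => by
    refine (laurentActHomog_mono _ _ _ _).trans (Eq.symm ?_)
    refine (congrArg (laurentActHomog 𝒜 J i a) (laurentActHomog_mono _ _ _ _)).trans ?_
    refine (laurentActHomog_mono _ _ _ _).trans ?_
    simp [mul_smul, add_assoc]

variable (𝒜 J) in
/-- The action of `R` on `J[T, T⁻¹]` through `r ↦ ∑ rᵢ T ^ i`. -/
noncomputable def laurentAct : R →+* AddMonoid.End (Laurent 𝒜 J) :=
  (DirectSum.toSemiring (laurentActHomog 𝒜 J) laurentActHomog_one laurentActHomog_mul).comp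
    (DirectSum.decomposeRingEquiv 𝒜).toRingHom

lemma laurentAct_mono {i : ℕ} {r : R} (hr : r ∈ 𝒜 i) (n : ℤ) (x : J) :
    laurentAct 𝒜 J r (mono 𝒜 n x) = mono 𝒜 (i + n) (r • x) := by
  have : DirectSum.decomposeRingEquiv 𝒜 r = DirectSum.of (fun i => 𝒜 i) i ⟨r, hr⟩ :=
    DirectSum.decompose_of_mem 𝒜 hr
  have h2 : laurentAct 𝒜 J r = laurentActHomog 𝒜 J i ⟨r, hr⟩ :=
    (congrArg (DirectSum.toSemiring (laurentActHomog 𝒜 J) laurentActHomog_one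
      laurentActHomog_mul) this).trans (DirectSum.toSemiring_of _ _ _ _ _)
  rw [h2]
  exact laurentActHomog_mono _ _ _ _

noncomputable instance : Module R (Laurent 𝒜 J) := Module.compHom _ (laurentAct 𝒜 J)

lemma smul_mono {i : ℕ} {r : R} (hr : r ∈ 𝒜 i) (n : ℤ) (x : J) :
    r • mono 𝒜 n x = mono 𝒜 (i + n) (r • x) := laurentAct_mono hr n x

variable (𝒜 J) in
/-- The graded module `J[T, T⁻¹]`. -/
noncomputable def laurent : GrMod.{v} 𝒜 where
  carrier := Laurent 𝒜 J
  deg n := (mono 𝒜 n).range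
  isInternal := isInternal_of_proj (fun n => (mono 𝒜 n).comp (coeff 𝒜 n))
    (fun n x => ⟨_, rfl⟩)
    (by
      rintro n k _ ⟨x, rfl⟩ hk
      simp [coeff_mono_ne hk])
    (fun x => ⟨Finsupp.support x, (Finsupp.sum_single x).symm⟩)
  smul_mem := by
    rintro i j r _ hr ⟨x, rfl⟩
    exact ⟨r • x, (smul_mono hr j x).symm⟩

/-- An additive map between graded modules that is `R`-linear on homogeneous elements. -/
def linOfHomog {A : Type*} [AddCommGroup A] [Module R A] (M : GrMod.{v} 𝒜) (f : M →+ A)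
    (h : ∀ (i : ℕ) (n : ℤ) (r : R) (x : M), r ∈ 𝒜 i → x ∈ M.deg n → f (r • x) = r • f x) :
    M →ₗ[R] A where
  toFun := f
  map_add' := f.map_add
  map_smul' r x := by
    induction x using induction_on with
    | zero => simp
    | add x y hx hy => simp only [smul_add, map_add, hx, hy]
    | homog n x hx =>
      induction r using DirectSum.Decomposition.inductionOn 𝒜 with
      | zero => simp
      | add a b ha hb => simp only [add_smul, map_add, ha, hb]
      | homogeneous a => exact h _ n _ x a.2 hx

/-- Evaluation of a Laurent polynomial at `T = 1`. -/
noncomputable def laurentEval : laurent 𝒜 J →ₗ[R] J :=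
  linOfHomog (laurent 𝒜 J) (laurentLift fun _ => AddMonoidHom.id J) (by
    rintro i n r _ hr ⟨x, rfl⟩
    have h : (r • (mono 𝒜 n x : laurent 𝒜 J) : laurent 𝒜 J) = mono 𝒜 (i + n) (r • x) :=
      smul_mono hr n x
    refine (congrArg _ h).trans ((laurentLift_mono _ _ _).trans ?_)
    exact congrArg (r • ·) (laurentLift_mono (𝒜 := 𝒜) (fun _ => AddMonoidHom.id J) n x).symm)

lemma laurentEval_mono (n : ℤ) (x : J) : laurentEval (𝒜 := 𝒜) (mono 𝒜 n x) = x :=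
  laurentLift_mono _ _ _

/-- The morphism of graded modules `x ↦ ∑ g (xₙ) T ^ n`. -/
noncomputable def toLaurent (g : M →ₗ[R] J) : M ⟶ laurent 𝒜 J where
  lin := linOfHomog (A := laurent 𝒜 J) M (toLaurentAux g) (by
    intro i n r x hr hx
    refine (toLaurentAux_apply g (M.smul_mem i n r x hr hx)).trans ?_
    rw [map_smul]
    refine (smul_mono hr n _).symm.trans ?_
    exact congrArg (r • ·) (toLaurentAux_apply g hx).symm)
  map_deg n x hx := ⟨g x, (toLaurentAux_apply g hx).symm⟩

lemma toLaurent_apply (g : M →ₗ[R] J) {n : ℤ} {x : M} (hx : x ∈ M.deg n) :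
    (toLaurent g).lin x = (mono 𝒜 n (g x) : Laurent 𝒜 J) := toLaurentAux_apply g hx

lemma laurentEval_toLaurent (g : M →ₗ[R] J) (x : M) : laurentEval ((toLaurent g).lin x) = g x := by
  induction x using induction_on with
  | zero => simp
  | add x y hx hy => simp only [map_add, hx, hy]
  | homog n x hx => rw [toLaurent_apply g hx]; exact laurentEval_mono _ _

lemma toLaurent_laurentEval (f : M ⟶ laurent 𝒜 J) : toLaurent (laurentEval.comp f.lin) = f :=
  hom_ext_homog fun n x hx => by
    rw [toLaurent_apply _ hx]
    obtain ⟨y, hy⟩ := f.map_deg n x hx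
    rw [LinearMap.comp_apply, ← hy]
    exact congrArg _ (laurentEval_mono n y)

lemma laurent_injective (J : ModuleCat.{v} R) [Injective J] : Injective (laurent 𝒜 J) where
  factors {X Y} g f hf := by
    have hfi := injective_of_mono f
    have : Mono (ModuleCat.ofHom f.lin) := (ModuleCat.mono_iff_injective _).2 hfi
    let e := Injective.factorThru (J := J) (ModuleCat.ofHom (laurentEval.comp g.lin))
      (ModuleCat.ofHom f.lin)
    have he : ModuleCat.ofHom f.lin ≫ e = ModuleCat.ofHom (laurentEval.comp g.lin) :=
      Injective.comp_factorThru _ _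
    have he' : ∀ x, e.hom (f.lin x) = laurentEval (g.lin x) := fun x =>
      congrArg (fun h : ModuleCat.of R X ⟶ J => h.hom x) he
    refine ⟨toLaurent e.hom, ?_⟩
    rw [← toLaurent_laurentEval g]
    refine hom_ext_homog fun n x hx => ?_
    rw [toLaurent_apply _ hx, comp_lin, LinearMap.comp_apply, toLaurent_apply _ (f.map_deg n x hx),
      he']
    rfl

/-- The category of graded modules has enough injectives. -/
instance [Small.{v} R] : EnoughInjectives (GrMod.{v} 𝒜) where
  presentation M := by
    let I := (EnoughInjectives.presentation (ModuleCat.of R M)).some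
    have := I.injective
    have := I.mono
    refine ⟨⟨laurent 𝒜 I.J, laurent_injective I.J, toLaurent I.f.hom,
      mono_of_injective _ fun x y hxy => ?_⟩⟩
    have := congrArg laurentEval hxy
    rw [laurentEval_toLaurent, laurentEval_toLaurent] at this
    exact (ModuleCat.mono_iff_injective I.f).1 inferInstance this

end EnoughInjectives

/-- `Γ_{R_+}(M) = {e ∈ M | R_t e = 0 for t ≫ 0}`. -/
def torsion (M : GrMod.{v} 𝒜) : Submodule R M where
  carrier := {e | ∃ t₀ : ℕ, ∀ t ≥ t₀, ∀ r ∈ 𝒜 t, r • e = 0}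
  zero_mem' := ⟨0, fun _ _ _ _ => smul_zero _⟩
  add_mem' := by
    rintro a b ⟨s, hs⟩ ⟨t, ht⟩
    exact ⟨max s t, fun k hk r hr => by
      rw [smul_add, hs k (le_of_max_le_left hk) r hr, ht k (le_of_max_le_right hk) r hr, add_zero]⟩
  smul_mem' := by
    rintro c a ⟨s, hs⟩
    exact ⟨s, fun k hk r hr => by rw [smul_comm, hs k hk r hr, smul_zero]⟩

lemma smul_proj (M : GrMod.{v} 𝒜) {i : ℕ} {r : R} (hr : r ∈ 𝒜 i) (n : ℤ) (x : M) :
    r • M.proj n x = M.proj (i + n) (r • x) := by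
  induction x using induction_on with
  | zero => simp
  | add x y hx hy => simp only [map_add, smul_add, hx, hy]
  | homog k x hx =>
    by_cases hk : k = n
    · subst hk
      rw [proj, proj, gradedProj_same _ hx, gradedProj_same _ (M.smul_mem _ _ _ _ hr hx)]
    · rw [proj, proj, gradedProj_ne _ hx hk, gradedProj_ne _ (M.smul_mem _ _ _ _ hr hx) (by omega),
        smul_zero]

lemma torsion_homog (M : GrMod.{v} 𝒜) (n : ℤ) (x : M) (hx : x ∈ M.torsion) :
    M.proj n x ∈ M.torsion := by
  obtain ⟨s, hs⟩ := hx
  exact ⟨s, fun k hk r hr => by rw [smul_proj M hr, hs k hk r hr, map_zero]⟩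

lemma map_torsion (f : M ⟶ N) (x : M) (hx : x ∈ M.torsion) : f.lin x ∈ N.torsion := by
  obtain ⟨s, hs⟩ := hx
  exact ⟨s, fun k hk r hr => by rw [← map_smul, hs k hk r hr, map_zero]⟩

variable (𝒜) in
/-- The functor `Γ_{R_+}` on graded modules. -/
def torsionFunctor : GrMod.{v} 𝒜 ⥤ GrMod.{v} 𝒜 where
  obj M := M.sub M.torsion M.torsion_homog
  map f := ⟨f.lin.restrict (map_torsion f), fun n x hx => f.map_deg n x.1 hx⟩

instance : (torsionFunctor.{v} 𝒜).Additive where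
  map_add := rfl

section Invariants

variable [GradedRing 𝒜] [Small.{v} R]

/-- The graded local cohomology module `H^i_{R_+}(M)`: the `i`-th right derived functor
of `Γ_{R_+}`. -/
noncomputable def localCohomology (i : ℕ) (M : GrMod.{v} 𝒜) : GrMod.{v} 𝒜 :=
  ((torsionFunctor.{v} 𝒜).rightDerived i).obj M

/-- `a(H) = sup {n | H_n ≠ 0}`, equal to `-∞` if `H = 0`. -/
noncomputable def topDegree (H : GrMod.{v} 𝒜) : EReal :=
  ⨆ (n : ℤ) (_ : H.deg n ≠ ⊥), ((n : ℝ) : EReal)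

/-- `a_i(M) = a(H^i_{R_+}(M))`. -/
noncomputable def aInv (i : ℕ) (M : GrMod.{v} 𝒜) : EReal := topDegree (localCohomology i M)

/-- `reg_t(M) = max {a_i(M) + i | i ≤ t}`. -/
noncomputable def partialReg (t : ℕ) (M : GrMod.{v} 𝒜) : EReal :=
  ⨆ (i : ℕ) (_ : i ≤ t), (aInv i M + (i : EReal))

/-- `a*_t(M) = max {a_i(M) | i ≤ t}`. -/
noncomputable def partialAStar (t : ℕ) (M : GrMod.{v} 𝒜) : EReal :=
  ⨆ (i : ℕ) (_ : i ≤ t), aInv i M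

end Invariants

/-- `a(P / K) = sup {n | (P / K)_n ≠ 0}` for homogeneous submodules `K ⊆ P` of `M`; the graded
piece `(P / K)_n = (P ∩ M_n) / (K ∩ M_n)` is nonzero if and only if some element of `P ∩ M_n`
is not in `K`. -/
noncomputable def topDegreeQuot (M : GrMod.{v} 𝒜) (P K : Submodule R M) : EReal :=
  ⨆ (n : ℤ) (_ : ∃ m ∈ M.deg n, m ∈ P ∧ m ∉ K), ((n : ℝ) : EReal)

/-- The submodule `K : I = {m ∈ M | I m ⊆ K}`. -/
def colon (M : GrMod.{v} 𝒜) (K : Submodule R M) (I : Ideal R) : Submodule R M where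
  carrier := {m | ∀ r ∈ I, r • m ∈ K}
  zero_mem' r _ := by rw [smul_zero]; exact K.zero_mem
  add_mem' ha hb r hr := by rw [smul_add]; exact K.add_mem (ha r hr) (hb r hr)
  smul_mem' c _ ha r hr := by rw [smul_comm]; exact K.smul_mem c (ha r hr)

/-- The submodule `Q_i M`, where `Q_i = (z_1, …, z_i)`; the sequence `z_1, …, z_s` is indexed by
`0, …, s - 1`, so that `z_{i+1}` is `z i`. -/
def partialQuot (M : GrMod.{v} 𝒜) {s : ℕ} (z : Fin s → R) (i : ℕ) : Submodule R M :=
  Ideal.span (z '' {j | (j : ℕ) < i}) • (⊤ : Submodule R M)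

/-- The homogeneous elements `z_1, …, z_s` form an `M`-filter-regular sequence: each `z_{i+1}` is
filter-regular on `M / Q_i M`, i.e. `((Q_i M : z_{i+1}) / Q_i M)_n = 0` for `n ≫ 0`. -/
def IsFilterRegularSeq (M : GrMod.{v} 𝒜) {s : ℕ} (z : Fin s → R) : Prop :=
  ∀ i : Fin s, (∃ d, z i ∈ 𝒜 d) ∧
    ∃ n₀ : ℤ, ∀ n ≥ n₀, ∀ m ∈ M.deg n, z i • m ∈ M.partialQuot z i → m ∈ M.partialQuot z i

/-- `a(z_1, …, z_s; M) = max {a((Q_i M : z_{i+1}) / Q_i M) | i = 0, …, s - 1}`. -/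
noncomputable def aSeq (M : GrMod.{v} 𝒜) {s : ℕ} (z : Fin s → R) : EReal :=
  ⨆ i : Fin s, M.topDegreeQuot (M.colon (M.partialQuot z i) (Ideal.span {z i}))
    (M.partialQuot z i)

/-- `s(z_1, …, z_s; M) = max {a((Q_i M : z_{i+1}) / Q_i M) - i | i = 0, …, s - 1}`. -/
noncomputable def sSeq (M : GrMod.{v} 𝒜) {s : ℕ} (z : Fin s → R) : EReal :=
  ⨆ i : Fin s, (M.topDegreeQuot (M.colon (M.partialQuot z i) (Ideal.span {z i}))
    (M.partialQuot z i) - ((i : ℕ) : EReal))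

end GrMod

/-! Let `z` be a linear form whose kernel on `M` is torsion, and let `C = M / zM`. Torsion modules
have no higher local cohomology, so in cohomological degrees at least 1 the modules `zM` and `M(-1)`
have the same local cohomology, and `0 → zM → M → C → 0` gives exact sequences `H^i(M) → H^i(C) →
H^{i+1}(M)(-1) → H^{i+1}(M)`, the last map being multiplication by `z`. Two facts about degrees
follow (`localCohomology_cokernel`). Descent: every class in `H^{i+1}(M)(-1)` is killed by a power
of `z`, so its last nonzero multiple `z^k x` lies in the kernel of `z` and comes from `H^i(C)`.
Hence `H^{i+1}(M)_n ≠ 0` forces `H^i(C)_m ≠ 0` for some `m ≥ n + 1`. Ascent: `H^i(C)_n ≠ 0` forces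
`H^i(M)_n ≠ 0` or `H^{i+1}(M)_{n-1} ≠ 0`.

Apply this to the successive quotients `M / Q_i M`. Iterated descent sends a nonzero degree `n` of
`H^j(M)` to a nonzero degree at least `n + j` of `H^0(M / Q_j M)`. Iterated ascent sends a nonzero
degree `n` of `H^0(M / Q_i M)` to the degree `n - k` of some `H^k(M)` with `k ≤ i`. Comparing upper
bounds gives both formulas, with `H^0(M / Q_i M)` in place of the colon quotients
(`iSup_eq_of_descent_ascent`). Finally `(Q_i M : I) / Q_i M`, with `I = (z_{i+1})` or `I = R_+`,
lies inside `H^0(M / Q_i M)` and reaches at least as high, since a nonzero torsion element has a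
nonzero multiple, in the same or a higher degree, killed by `I`.

The vanishing for torsion modules (`localCohomology_succ_eq_zero`) rests on embedding a torsion
module in a torsion injective one. By Artin–Rees the `I`-power torsion of an injective module over a
noetherian ring is injective (`powTorsion_baer`). The long exact sequence comes from the horseshoe
lemma. -/

namespace CategoryTheory

open HomologicalComplex

/-! ### Injective resolutions, the horseshoe lemma and the long exact sequence of right derived
functors -/

section Horseshoe

variable {C : Type u} [Category.{v} C] [Abelian C]

namespace InjectiveResolution

/-- The augmentation `Z ⟶ I⁰` of an injective resolution. -/
noncomputable def aug {Z : C} (I : InjectiveResolution Z) : Z ⟶ I.cocomplex.X 0 := I.ι.f 0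

lemma aug_d {Z : C} (I : InjectiveResolution Z) : I.aug ≫ I.cocomplex.d 0 1 = 0 :=
  I.ι_f_zero_comp_complex_d

instance {Z : C} (I : InjectiveResolution Z) : Mono I.aug :=
  inferInstanceAs (Mono (I.ι.f 0))

lemma aug_exact {Z : C} (I : InjectiveResolution Z) :
    (ShortComplex.mk I.aug (I.cocomplex.d 0 1) I.aug_d).Exact := I.exact₀

section OfExact

variable {Z : C} (K : CochainComplex C ℕ)
    (ε : Z ⟶ K.X 0) (hε : ε ≫ K.d 0 1 = 0)

/-- The morphism of complexes defined by an augmentation. -/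
noncomputable def ofExactι : (CochainComplex.single₀ C).obj Z ⟶ K :=
  (CochainComplex.fromSingle₀Equiv K Z).symm ⟨ε, hε⟩

lemma ofExactι_f : (ofExactι K ε hε).f 0 = ε :=
  CochainComplex.fromSingle₀Equiv_symm_apply_f_zero ε hε

variable [∀ n, Injective (K.X n)] [Mono ε]
  (h₀ : (ShortComplex.mk ε (K.d 0 1) hε).Exact) (hK : ∀ n, K.ExactAt (n + 1))

/-- An augmented exact complex of injectives as an injective resolution. -/
noncomputable def ofExact : InjectiveResolution Z where
  cocomplex := K
  ι := ofExactι K ε hε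
  quasiIso := ⟨fun n => by
    cases n with
    | zero =>
      rw [CochainComplex.quasiIsoAt₀_iff, ShortComplex.quasiIso_iff_of_zeros _ rfl rfl
        (K.shape _ _ (by simp))]
      constructor
      · refine (ShortComplex.exact_iff_of_iso ?_).2 h₀
        refine ShortComplex.isoMk (Iso.refl _) (Iso.refl _) (Iso.refl _) ?_ ?_
        · exact (Category.id_comp _).trans
            ((ofExactι_f K ε hε).symm.trans (Category.comp_id _).symm)
        · exact (Category.id_comp _).trans (Category.comp_id _).symm
      · have : Mono ((ofExactι K ε hε).f 0) := by rw [ofExactι_f]; assumption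
        exact this
    | succ n =>
      rw [quasiIsoAt_iff_exactAt]
      · exact hK n
      · apply CochainComplex.exactAt_succ_single_obj⟩

lemma ofExact_aug : (ofExact K ε hε h₀ hK).aug = ε := ofExactι_f K ε hε

end OfExact

/-- A morphism from `Z` to a complex of injectives `J` whose composition with the differential
vanishes extends to an injective resolution of `Z`. -/
lemma exists_extend {Z : C} (I : InjectiveResolution Z) (J : CochainComplex C ℕ)
    [∀ n, Injective (J.X n)] (τ : Z ⟶ J.X 0) (hτ : τ ≫ J.d 0 1 = 0) :
    ∃ σ : I.cocomplex ⟶ J, I.aug ≫ σ.f 0 = τ := by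
  let f₀ : I.cocomplex.X 0 ⟶ J.X 0 := Injective.factorThru τ I.aug
  have hf₀ : I.aug ≫ f₀ = τ := Injective.comp_factorThru τ I.aug
  have h₀ : I.aug ≫ f₀ ≫ J.d 0 1 = 0 := by
    rw [← Category.assoc, hf₀, hτ]
  let f₁ : I.cocomplex.X 1 ⟶ J.X 1 := I.aug_exact.descToInjective (f₀ ≫ J.d 0 1) h₀
  have hf₁ : I.cocomplex.d 0 1 ≫ f₁ = f₀ ≫ J.d 0 1 := I.aug_exact.comp_descToInjective _ _
  exact ⟨CochainComplex.mkHom _ _ f₀ f₁ hf₁.symm fun n g =>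
    ⟨(I.exact_succ n).descToInjective (g.2.1 ≫ J.d (n + 1) (n + 2))
      (by have := g.2.2; dsimp only at *; simp [← reassoc_of% this]),
      ((I.exact_succ n).comp_descToInjective _ _).symm⟩, hf₀⟩

end InjectiveResolution

section Twisted

variable (K L : CochainComplex C ℕ) (s : ∀ n, L.X n ⟶ K.X (n + 1))
  (hs : ∀ n, s n ≫ K.d (n + 1) (n + 1 + 1) + L.d n (n + 1) ≫ s (n + 1) = 0)

/-- The complex `K ⊞ L` with differential twisted by `s`. -/
noncomputable abbrev twistedSum : CochainComplex C ℕ :=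
  CochainComplex.of (fun n => K.X n ⊞ L.X n)
    (fun n => biprod.lift (biprod.desc (K.d n (n + 1)) (s n)) (biprod.snd ≫ L.d n (n + 1)))
    (fun n => by
      ext
      · simp
      · simp
      · simpa using hs n
      · simp)

lemma twistedSum_d (n : ℕ) : (twistedSum K L s hs).d n (n + 1) =
    biprod.lift (biprod.desc (K.d n (n + 1)) (s n)) (biprod.snd ≫ L.d n (n + 1)) :=
  CochainComplex.of_d (fun n => K.X n ⊞ L.X n)
    (fun n => biprod.lift (biprod.desc (K.d n (n + 1)) (s n)) (biprod.snd ≫ L.d n (n + 1))) n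

/-- The inclusion of `K` in the twisted sum. -/
noncomputable def twistedInl : K ⟶ twistedSum K L s hs where
  f n := (biprod.inl : K.X n ⟶ K.X n ⊞ L.X n)
  comm' i j hij := by
    obtain rfl : i + 1 = j := hij
    rw [twistedSum_d]
    apply biprod.hom_ext <;> simp

/-- The projection of the twisted sum to `L`. -/
noncomputable def twistedSnd : twistedSum K L s hs ⟶ L where
  f n := (biprod.snd : K.X n ⊞ L.X n ⟶ L.X n)
  comm' i j hij := by
    obtain rfl : i + 1 = j := hij
    rw [twistedSum_d]
    simp

/-- The degreewise split sequence `0 ⟶ K ⟶ K ⊞ L ⟶ L ⟶ 0`. -/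
noncomputable abbrev twistedShortComplex : ShortComplex (CochainComplex C ℕ) :=
  ShortComplex.mk (twistedInl K L s hs) (twistedSnd K L s hs) (by
    ext n
    exact biprod.inl_snd)

/-- The splitting in degree `n`. -/
noncomputable def twistedSplitting (n : ℕ) :
    ((twistedShortComplex K L s hs).map (HomologicalComplex.eval C _ n)).Splitting where
  r := (biprod.fst : K.X n ⊞ L.X n ⟶ K.X n)
  s := (biprod.inr : L.X n ⟶ K.X n ⊞ L.X n)
  f_r := biprod.inl_fst
  s_g := biprod.inr_snd
  id := biprod.total

end Twisted

/-- The horseshoe lemma. -/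
theorem exists_horseshoe [HasInjectiveResolutions C] (S : ShortComplex C) (hS : S.ShortExact) :
    ∃ (I₁ : InjectiveResolution S.X₁) (I₂ : InjectiveResolution S.X₂)
      (I₃ : InjectiveResolution S.X₃) (φ : I₁.cocomplex ⟶ I₂.cocomplex)
      (ψ : I₂.cocomplex ⟶ I₃.cocomplex) (w : φ ≫ ψ = 0),
      I₁.aug ≫ φ.f 0 = S.f ≫ I₂.aug ∧ I₂.aug ≫ ψ.f 0 = S.g ≫ I₃.aug ∧
      ∀ n, Nonempty ((ShortComplex.mk φ ψ w).map (HomologicalComplex.eval C _ n)).Splitting := by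
  have := hS.mono_f
  have := hS.epi_g
  let I := injectiveResolution S.X₁
  let J := injectiveResolution S.X₃
  -- The middle augmentation will be `(β, S.g ≫ J.aug)`. The defect `β ≫ d` vanishes on `S.X₁`, so
  -- its negative descends to `τ` on `S.X₃`. Extending `τ` along `J` yields the off-diagonal part of
  -- the differential.
  let β : S.X₂ ⟶ I.cocomplex.X 0 := Injective.factorThru I.aug S.f
  have hβ : S.f ≫ β = I.aug := Injective.comp_factorThru _ _
  have hId := I.aug_d
  have hJd := J.aug_d
  have hτ₀ : S.f ≫ (-(β ≫ I.cocomplex.d 0 1)) = 0 := by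
    rw [Preadditive.comp_neg, reassoc_of% hβ, hId, neg_zero]
  let τ : S.X₃ ⟶ I.cocomplex.X 1 := hS.exact.desc _ hτ₀
  have hτ : S.g ≫ τ = -(β ≫ I.cocomplex.d 0 1) := hS.exact.g_desc _ hτ₀
  have hinj : ∀ n, Injective ((CochainComplex.truncate.obj I.cocomplex).X n) := fun n =>
    I.injective (n + 1)
  have hτd : τ ≫ I.cocomplex.d 1 2 = 0 := by
    rw [← cancel_epi S.g, reassoc_of% hτ]
    simp
  obtain ⟨σ, hσ⟩ := J.exists_extend (CochainComplex.truncate.obj I.cocomplex) τ hτd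
  have hcomm : ∀ n, σ.f n ≫ I.cocomplex.d (n + 1) (n + 2) =
      J.cocomplex.d n (n + 1) ≫ σ.f (n + 1) := fun n => σ.comm n (n + 1)
  -- `truncate` shifts without changing the sign of the differential, so `σ` commutes with the
  -- differentials. The alternating sign makes `s` anticommute with them, as the twisted
  -- differential needs in order to square to zero.
  let s : ∀ n, J.cocomplex.X n ⟶ I.cocomplex.X (n + 1) := fun n => ((-1 : ℤ) ^ n) • σ.f n
  have hs : ∀ n, s n ≫ I.cocomplex.d (n + 1) (n + 1 + 1) +
      J.cocomplex.d n (n + 1) ≫ s (n + 1) = 0 := by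
    intro n
    have aux : ∀ {W X Y Z : C} {f : W ⟶ X} {k : X ⟶ Z} {l : W ⟶ Y} {g : Y ⟶ Z} (a : ℤ),
        f ≫ k = l ≫ g → (a • f) ≫ k + l ≫ ((a * -1) • g) = 0 := by
      intro _ _ _ _ _ _ _ _ a h
      simp [h]
    have := aux ((-1) ^ n) (hcomm n)
    rw [← pow_succ] at this
    exact this
  have hs₀ : J.aug ≫ s 0 = τ := by
    simp only [s, pow_zero, one_smul]
    exact hσ
  clear_value s
  let T := twistedSum I.cocomplex J.cocomplex s hs
  have hTd := twistedSum_d I.cocomplex J.cocomplex s hs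
  have hTi : ∀ n, Injective (T.X n) := fun n =>
    inferInstanceAs (Injective (I.cocomplex.X n ⊞ J.cocomplex.X n))
  let ε : S.X₂ ⟶ I.cocomplex.X 0 ⊞ J.cocomplex.X 0 := biprod.lift β (S.g ≫ J.aug)
  have hεd : ε ≫ biprod.lift (biprod.desc (I.cocomplex.d 0 1) (s 0))
      (biprod.snd ≫ J.cocomplex.d 0 1) = 0 := by
    apply biprod.hom_ext
    · simp [ε, biprod.lift_desc, hs₀, hτ]
    · simp [ε, hJd]
  have hεm : Mono ε := by
    refine Preadditive.mono_of_cancel_zero _ fun {A} x hx => ?_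
    have h₂ : x ≫ S.g = 0 := by
      rw [← cancel_mono J.aug]
      simpa [ε] using hx =≫ biprod.snd
    have h₁ : x ≫ β = 0 := by simpa [ε] using hx =≫ biprod.fst
    rw [← hS.exact.lift_f x h₂] at h₁ ⊢
    rw [Category.assoc, hβ] at h₁
    rw [zero_of_comp_mono _ h₁, zero_comp]
  -- Diagram chase up to refinement: the `J`-component of a cocycle `x` comes from `S.X₃`, hence
  -- from some `b` in `S.X₂`. The difference `x - ε b` then has only an `I`-component, which is a
  -- cocycle and so comes from `S.X₁`.
  have hex : (ShortComplex.mk ε _ hεd).Exact := by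
    rw [ShortComplex.exact_iff_exact_up_to_refinements]
    intro A x hx
    dsimp at x hx
    have hx₁ : x ≫ biprod.desc (I.cocomplex.d 0 1) (s 0) = 0 := by
      simpa using hx =≫ biprod.fst
    have hx₂ : (x ≫ biprod.snd) ≫ J.cocomplex.d 0 1 = 0 := by
      simpa using hx =≫ biprod.snd
    obtain ⟨A₁, π₁, _, c, hc⟩ := J.aug_exact.exact_up_to_refinements _ hx₂
    obtain ⟨A₂, π₂, _, b, hb⟩ := surjective_up_to_refinements_of_epi S.g c
    dsimp at hc
    have hy : (π₂ ≫ π₁ ≫ x - b ≫ ε) ≫ biprod.snd = 0 := by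
      simp [ε, hc, ← reassoc_of% hb]
    have hy' : (π₂ ≫ π₁ ≫ x - b ≫ ε) ≫ biprod.desc (I.cocomplex.d 0 1) (s 0) = 0 := by
      have : ε ≫ biprod.desc (I.cocomplex.d 0 1) (s 0) = 0 := by
        simpa using hεd =≫ biprod.fst
      simp [hx₁, this]
    generalize hyy : π₂ ≫ π₁ ≫ x - b ≫ ε = y at hy hy'
    have hyeq : y = (y ≫ biprod.fst) ≫ biprod.inl := by
      apply biprod.hom_ext <;> simp [hy]
    obtain ⟨A₃, π₃, _, a, ha⟩ := I.aug_exact.exact_up_to_refinements (y ≫ biprod.fst) (by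
      rw [hyeq] at hy'
      simpa using hy')
    dsimp at ha
    refine ⟨A₃, π₃ ≫ π₂ ≫ π₁, inferInstance, a ≫ S.f + π₃ ≫ b, ?_⟩
    have h1 : a ≫ S.f ≫ ε = π₃ ≫ y := by
      rw [hyeq, ← Category.assoc π₃, ha]
      apply biprod.hom_ext
      · simp [ε, hβ]
      · simp [ε]
    simp only [Category.assoc, Preadditive.add_comp, h1, ← hyy]
    simp
  have hses : (twistedShortComplex I.cocomplex J.cocomplex s hs).ShortExact :=
    HomologicalComplex.shortExact_of_degreewise_shortExact _ fun n =>
      (twistedSplitting I.cocomplex J.cocomplex s hs n).shortExact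
  have hexn : ∀ n, T.ExactAt (n + 1) := by
    intro n
    rw [exactAt_iff_isZero_homology]
    refine (hses.homology_exact₂ (n + 1)).isZero_X₂ ?_ ?_
    · exact ((exactAt_iff_isZero_homology _ _).1 (I.cocomplex_exactAt_succ n)).eq_of_src _ _
    · exact ((exactAt_iff_isZero_homology _ _).1 (J.cocomplex_exactAt_succ n)).eq_of_tgt _ _
  have hd0 : biprod.lift (biprod.desc (I.cocomplex.d 0 1) (s 0))
      (biprod.snd ≫ J.cocomplex.d 0 1) = T.d 0 1 := (hTd 0).symm
  have hε₀ : (ShortComplex.mk ε (T.d 0 1) (hd0 ▸ hεd)).Exact := by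
    refine (ShortComplex.exact_iff_of_iso ?_).2 hex
    refine ShortComplex.isoMk (Iso.refl _) (Iso.refl _) (Iso.refl _) ?_ ?_
    · simp
    · dsimp; rw [← hd0]; simp
  refine ⟨I, .ofExact T ε (hd0 ▸ hεd) hε₀ hexn, J, twistedInl I.cocomplex J.cocomplex s hs,
    twistedSnd I.cocomplex J.cocomplex s hs, (twistedShortComplex I.cocomplex J.cocomplex s hs).zero,
    ?_, ?_, fun n => ⟨twistedSplitting I.cocomplex J.cocomplex s hs n⟩⟩
  · rw [InjectiveResolution.ofExact_aug]
    change I.aug ≫ biprod.inl = S.f ≫ ε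
    apply biprod.hom_ext <;> simp [ε, hβ]
  · rw [InjectiveResolution.ofExact_aug]
    change ε ≫ biprod.snd = S.g ≫ J.aug
    simp [ε]

section LongExact

variable [HasInjectiveResolutions C] {D : Type*} [Category* D] [Abelian D] (F : C ⥤ D) [F.Additive]
  (S : ShortComplex C) (hS : S.ShortExact)

include hS

/-- The long exact sequence of right derived functors. -/
theorem exists_rightDerived_long_exact (n : ℕ) :
    (∃ w₀ : (F.rightDerived n).map S.f ≫ (F.rightDerived n).map S.g = 0,
      (ShortComplex.mk _ _ w₀).Exact) ∧
    ∃ (δ : (F.rightDerived n).obj S.X₃ ⟶ (F.rightDerived (n + 1)).obj S.X₁)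
      (w₁ : (F.rightDerived n).map S.g ≫ δ = 0) (w₂ : δ ≫ (F.rightDerived (n + 1)).map S.f = 0),
      (ShortComplex.mk _ _ w₁).Exact ∧ (ShortComplex.mk _ _ w₂).Exact := by
  obtain ⟨I₁, I₂, I₃, φ, ψ, w, hφ, hψ, hsplit⟩ := exists_horseshoe S hS
  let T : ShortComplex (CochainComplex D ℕ) :=
    (ShortComplex.mk φ ψ w).map (F.mapHomologicalComplex (ComplexShape.up ℕ))
  -- An additive functor preserves splittings, so the sequence stays short exact in each degree
  -- although `F` need not be exact.
  have hT : T.ShortExact := HomologicalComplex.shortExact_of_degreewise_shortExact _ fun n =>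
    ((hsplit n).some.map F).shortExact
  let e₁ : ∀ n, (F.rightDerived n).obj S.X₁ ≅ T.X₁.homology n := fun n => I₁.isoRightDerivedObj F n
  let e₂ : ∀ n, (F.rightDerived n).obj S.X₂ ≅ T.X₂.homology n := fun n => I₂.isoRightDerivedObj F n
  let e₃ : ∀ n, (F.rightDerived n).obj S.X₃ ≅ T.X₃.homology n := fun n => I₃.isoRightDerivedObj F n
  have hf : ∀ n, (F.rightDerived n).map S.f ≫ (e₂ n).hom =
      (e₁ n).hom ≫ homologyMap T.f n := fun n =>
    InjectiveResolution.isoRightDerivedObj_hom_naturality S.f I₁ I₂ φ hφ F n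
  have hg : ∀ n, (F.rightDerived n).map S.g ≫ (e₃ n).hom =
      (e₂ n).hom ≫ homologyMap T.g n := fun n =>
    InjectiveResolution.isoRightDerivedObj_hom_naturality S.g I₂ I₃ ψ hψ F n
  clear_value e₁ e₂ e₃
  have h₀ : homologyMap T.f n ≫ homologyMap T.g n = 0 := by
    rw [← homologyMap_comp, T.zero, homologyMap_zero]
  constructor
  · have w₀ : (F.rightDerived n).map S.f ≫ (F.rightDerived n).map S.g = 0 := by
      rw [← cancel_mono (e₃ n).hom, Category.assoc, hg, ← Category.assoc, hf, Category.assoc, h₀,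
        comp_zero, zero_comp]
    exact ⟨w₀, (ShortComplex.exact_iff_of_iso
      (ShortComplex.isoMk (e₁ n) (e₂ n) (e₃ n) (hf n).symm (hg n).symm)).2 (hT.homology_exact₂ n)⟩
  · have h₁ : homologyMap T.g n ≫ hT.δ n (n + 1) rfl = 0 := hT.comp_δ n (n + 1) rfl
    have h₂ : hT.δ n (n + 1) rfl ≫ homologyMap T.f (n + 1) = 0 := hT.δ_comp n (n + 1) rfl
    refine ⟨(e₃ n).hom ≫ hT.δ n (n + 1) rfl ≫ (e₁ (n + 1)).inv, ?_, ?_, ?_, ?_⟩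
    · rw [← Category.assoc, hg, Category.assoc, ← Category.assoc (homologyMap T.g n), h₁, zero_comp,
        comp_zero]
    · rw [← cancel_mono (e₂ (n + 1)).hom]
      simp only [Category.assoc, zero_comp]
      rw [hf, Iso.inv_hom_id_assoc, h₂, comp_zero]
    · exact (ShortComplex.exact_iff_of_iso
        (ShortComplex.isoMk (e₂ n) (e₃ n) (e₁ (n + 1)) (hg n).symm (by simp))).2
        (hT.homology_exact₃ n (n + 1) rfl)
    · exact (ShortComplex.exact_iff_of_iso
        (ShortComplex.isoMk (e₃ n) (e₁ (n + 1)) (e₂ (n + 1)) (by simp) (hf (n + 1)).symm)).2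
        (hT.homology_exact₁ n (n + 1) rfl)

end LongExact

end Horseshoe

end CategoryTheory

/-! ### Exactness and cohomology of graded modules in terms of elements -/

namespace GrMod

open HomologicalComplex

variable {R : Type u} [CommRing R] {𝒜 : ℕ → AddSubgroup R} {M N P : GrMod.{v} 𝒜}

lemma epi_of_surjective (f : M ⟶ N) (hf : Function.Surjective f.lin) : Epi f :=
  ⟨fun {W} _ _ e => hom_ext fun x => by
    obtain ⟨y, rfl⟩ := hf x
    exact congrArg (fun k : M ⟶ W => k.lin y) e⟩

lemma comp_lin_apply (f : M ⟶ N) (g : N ⟶ P) (x : M) : (f ≫ g).lin x = g.lin (f.lin x) := rfl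

lemma lin_apply_of_eq {f g : M ⟶ N} (h : f = g) (x : M) : f.lin x = g.lin x := by rw [h]

/-- The inclusion of the kernel of `S.g` serves as the universal generalized element: exactness up
to refinement lifts it along an epimorphism, and epimorphisms are surjective. -/
lemma exact_apply {S : ShortComplex (GrMod.{v} 𝒜)} (hS : S.Exact) (x : S.X₂)
    (hx : S.g.lin x = 0) : ∃ y, S.f.lin y = x := by
  obtain ⟨A, π, _, g, hg⟩ := hS.exact_up_to_refinements _ (subι_comp S.g)
  obtain ⟨a, ha⟩ := surjective_of_epi π ⟨x, hx⟩
  refine ⟨g.lin a, ?_⟩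
  rw [← comp_lin_apply, ← hg, comp_lin_apply, ha]
  rfl

lemma exact_of_apply {S : ShortComplex (GrMod.{v} 𝒜)}
    (h : ∀ x, S.g.lin x = 0 → ∃ y, S.f.lin y = x) : S.Exact := by
  rw [ShortComplex.exact_iff_epi_toCycles]
  refine epi_of_surjective _ fun c => ?_
  obtain ⟨y, hy⟩ := h (S.iCycles.lin c) (by
    rw [← comp_lin_apply, S.iCycles_g]; rfl)
  refine ⟨y, injective_of_mono S.iCycles ?_⟩
  rw [← comp_lin_apply, S.toCycles_i, hy]

lemma shortExact_of_apply {S : ShortComplex (GrMod.{v} 𝒜)} (hf : Function.Injective S.f.lin)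
    (hg : Function.Surjective S.g.lin) (h : ∀ x, S.g.lin x = 0 → ∃ y, S.f.lin y = x) :
    S.ShortExact where
  exact := exact_of_apply h
  mono_f := mono_of_injective _ hf
  epi_g := epi_of_surjective _ hg

lemma exists_mem_deg_of_map (f : M ⟶ N) {n : ℤ} {y : N} (hy : y ∈ N.deg n) {x : M}
    (hx : f.lin x = y) : ∃ x' ∈ M.deg n, f.lin x' = y :=
  ⟨M.proj n x, gradedProj_mem _ _ _, by rw [map_proj, hx]; exact gradedProj_same _ hy⟩

lemma isZero_iff : IsZero M ↔ ∀ x : M, x = 0 := by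
  rw [IsZero.iff_id_eq_zero]
  exact ⟨fun h x => lin_apply_of_eq h x, fun h => hom_ext fun x => (h x).trans (h _).symm⟩

lemma inv_hom_apply (e : M ≅ N) (x : N) : e.hom.lin (e.inv.lin x) = x := by
  rw [← comp_lin_apply, e.inv_hom_id]; rfl

lemma hom_inv_apply (e : M ≅ N) (x : M) : e.inv.lin (e.hom.lin x) = x := by
  rw [← comp_lin_apply, e.hom_inv_id]; rfl

lemma iso_injective (e : M ≅ N) : Function.Injective e.hom.lin :=
  Function.LeftInverse.injective (hom_inv_apply e)

lemma deg_ne_bot_iff {n : ℤ} : M.deg n ≠ ⊥ ↔ ∃ x ∈ M.deg n, x ≠ 0 := by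
  rw [ne_eq, AddSubgroup.eq_bot_iff_forall]
  push Not
  rfl

lemma deg_ne_bot_of_iso (e : M ≅ N) {n : ℤ} (h : M.deg n ≠ ⊥) : N.deg n ≠ ⊥ := by
  rw [deg_ne_bot_iff] at h ⊢
  obtain ⟨x, hx, h0⟩ := h
  exact ⟨e.hom.lin x, e.hom.map_deg n x hx, fun h => h0 (iso_injective e (by rw [h, map_zero]))⟩

lemma deg_ne_bot_iff_of_iso (e : M ≅ N) {n : ℤ} : M.deg n ≠ ⊥ ↔ N.deg n ≠ ⊥ :=
  ⟨deg_ne_bot_of_iso e, deg_ne_bot_of_iso e.symm⟩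

section Homology

variable (K L : CochainComplex (GrMod.{v} 𝒜) ℕ) (i : ℕ)

/-- The cocycle `y` represents the cohomology class `h`. -/
def Represents (h : K.homology i) (y : K.X i) : Prop :=
  ∃ c : K.cycles i, (K.iCycles i).lin c = y ∧ (K.homologyπ i).lin c = h

variable {K L i}

lemma exists_represents {n : ℤ} {h : K.homology i} (hh : h ∈ (K.homology i).deg n) :
    ∃ y ∈ (K.X i).deg n, Represents K i h y := by
  obtain ⟨c, hc⟩ := surjective_of_epi (K.homologyπ i) h
  obtain ⟨c, hcn, hc⟩ := exists_mem_deg_of_map _ hh hc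
  exact ⟨_, (K.iCycles i).map_deg n c hcn, c, rfl, hc⟩

lemma represents_of_cocycle {n : ℤ} {y : K.X i} (hy : y ∈ (K.X i).deg n)
    (hd : (K.d i (i + 1)).lin y = 0) : ∃ h ∈ (K.homology i).deg n, Represents K i h y := by
  let l := K.liftCycles (subι _ (LinearMap.ker (K.d i (i + 1)).lin) (ker_homog _)) (i + 1)
    (by simp) (subι_comp (K.d i (i + 1)))
  have hl : l ≫ K.iCycles i = subι _ _ _ := K.liftCycles_i _ _ _ _
  exact ⟨(K.homologyπ i).lin (l.lin ⟨y, hd⟩),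
    (K.homologyπ i).map_deg n _ (l.map_deg n _ hy), l.lin ⟨y, hd⟩, lin_apply_of_eq hl ⟨y, hd⟩, rfl⟩

lemma Represents.cocycle {h : K.homology i} {y : K.X i} (hy : Represents K i h y) (j : ℕ) :
    (K.d i j).lin y = 0 := by
  obtain ⟨c, rfl, rfl⟩ := hy
  rw [← comp_lin_apply, K.iCycles_d]
  rfl

/-- Homology is the cokernel of the map to cycles. For `i = 0` the convention is `prev 0 = 0` with
zero differential, so the right-hand side then says `y = 0`. -/
lemma Represents.eq_zero_iff {h : K.homology i} {y : K.X i} (hy : Represents K i h y) :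
    h = 0 ↔ ∃ w, (K.d ((ComplexShape.up ℕ).prev i) i).lin w = y := by
  obtain ⟨c, rfl, rfl⟩ := hy
  have hex : (ShortComplex.mk _ _ (K.toCycles_comp_homologyπ
      ((ComplexShape.up ℕ).prev i) i)).Exact :=
    ShortComplex.exact_of_g_is_cokernel _ (K.homologyIsCokernel _ _ rfl)
  constructor
  · intro h0
    obtain ⟨w, hw⟩ := exact_apply hex c h0
    refine ⟨w, ?_⟩
    dsimp at hw
    rw [← hw, ← comp_lin_apply, K.toCycles_i]
  · rintro ⟨w, hw⟩
    rw [← K.toCycles_i, comp_lin_apply] at hw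
    rw [← injective_of_mono (K.iCycles i) hw, ← comp_lin_apply, K.toCycles_comp_homologyπ]
    rfl

lemma Represents.map (φ : K ⟶ L) {h : K.homology i} {y : K.X i} (hy : Represents K i h y) :
    Represents L i ((homologyMap φ i).lin h) ((φ.f i).lin y) := by
  obtain ⟨c, rfl, rfl⟩ := hy
  refine ⟨(cyclesMap φ i).lin c, ?_, ?_⟩
  · rw [← comp_lin_apply, cyclesMap_i, comp_lin_apply]
  · rw [← comp_lin_apply, ← homologyπ_naturality, comp_lin_apply]

lemma Represents.smul (r : R) {h : K.homology i} {y : K.X i} (hy : Represents K i h y) :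
    Represents K i (r • h) (r • y) := by
  obtain ⟨c, rfl, rfl⟩ := hy
  exact ⟨r • c, map_smul _ _ _, map_smul _ _ _⟩

lemma homology_deg_ne_bot_iff {n : ℤ} : (K.homology i).deg n ≠ ⊥ ↔
    ∃ y ∈ (K.X i).deg n, (K.d i (i + 1)).lin y = 0 ∧
      ¬ ∃ w, (K.d ((ComplexShape.up ℕ).prev i) i).lin w = y := by
  rw [deg_ne_bot_iff]
  constructor
  · rintro ⟨h, hh, h0⟩
    obtain ⟨y, hy, hr⟩ := exists_represents hh
    exact ⟨y, hy, hr.cocycle _, fun hw => h0 (hr.eq_zero_iff.2 hw)⟩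
  · rintro ⟨y, hy, hd, hw⟩
    obtain ⟨h, hh, hr⟩ := represents_of_cocycle hy hd
    exact ⟨h, hh, fun h0 => hw (hr.eq_zero_iff.1 h0)⟩

end Homology

/-! ### The torsion functor and its derived functors -/

section Torsion

/-- An injective map reflects torsion: if `r • f y = 0` then `r • y = 0`. Left exactness is what
identifies `H^0` with the torsion submodule. -/
instance : PreservesFiniteLimits (torsionFunctor.{v} 𝒜) := by
  refine ((torsionFunctor.{v} 𝒜).preservesFiniteLimits_tfae.out 0 3).1 fun S hS => ?_
  have hinj : Function.Injective S.f.lin := have := hS.mono_f; injective_of_mono S.f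
  constructor
  · refine exact_of_apply fun x hx => ?_
    obtain ⟨y, hy⟩ := exact_apply hS.exact x.1 (congrArg Subtype.val hx)
    obtain ⟨t, ht⟩ := x.2
    refine ⟨⟨y, t, fun k hk r hr => hinj ?_⟩, Subtype.ext hy⟩
    rw [map_smul, map_zero, hy, ht k hk r hr]
  · exact mono_of_injective _ fun x y hxy => Subtype.ext (hinj (congrArg Subtype.val hxy))

variable [GradedRing 𝒜] [Small.{v} R]

/-- The map on local cohomology induced by a morphism. -/
noncomputable def localCohomologyMap (i : ℕ) (f : M ⟶ N) :
    localCohomology i M ⟶ localCohomology i N :=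
  ((torsionFunctor.{v} 𝒜).rightDerived i).map f

lemma localCohomologyMap_comp (i : ℕ) (f : M ⟶ N) (g : N ⟶ P) :
    localCohomologyMap i (f ≫ g) = localCohomologyMap i f ≫ localCohomologyMap i g :=
  ((torsionFunctor.{v} 𝒜).rightDerived i).map_comp f g

/-- `H^0_{R_+}(M) = Γ_{R_+}(M)`. -/
noncomputable def localCohomologyZeroIso (M : GrMod.{v} 𝒜) :
    localCohomology 0 M ≅ (torsionFunctor.{v} 𝒜).obj M :=
  (torsionFunctor.{v} 𝒜).rightDerivedZeroIsoSelf.app M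

lemma localCohomology_zero_deg_ne_bot_iff {n : ℤ} :
    (localCohomology 0 M).deg n ≠ ⊥ ↔ ∃ x ∈ M.deg n, x ∈ M.torsion ∧ x ≠ 0 := by
  rw [deg_ne_bot_iff_of_iso (localCohomologyZeroIso M), deg_ne_bot_iff]
  constructor
  · rintro ⟨x, hx, h0⟩
    exact ⟨x.1, hx, x.2, fun h => h0 (Subtype.ext h)⟩
  · rintro ⟨x, hx, ht, h0⟩
    exact ⟨⟨x, ht⟩, hx, fun h => h0 (congrArg Subtype.val h)⟩

/-- A nonzero class of degree `n` is a homogeneous torsion cocycle which is not the coboundary of a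
torsion cochain. Allowing an arbitrary resolution makes it possible to compare `M` with its shifts.
-/
lemma localCohomology_deg_ne_bot_iff (I : InjectiveResolution M) {i : ℕ} {n : ℤ} :
    (localCohomology i M).deg n ≠ ⊥ ↔
      ∃ y ∈ (I.cocomplex.X i).deg n, y ∈ (I.cocomplex.X i).torsion ∧
        (I.cocomplex.d i (i + 1)).lin y = 0 ∧
      ¬ ∃ w ∈ (I.cocomplex.X ((ComplexShape.up ℕ).prev i)).torsion,
        (I.cocomplex.d ((ComplexShape.up ℕ).prev i) i).lin w = y := by
  refine (deg_ne_bot_iff_of_iso (M := localCohomology i M)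
    (I.isoRightDerivedObj (torsionFunctor.{v} 𝒜) i)).trans ?_
  refine (homology_deg_ne_bot_iff (K := ((torsionFunctor.{v} 𝒜).mapHomologicalComplex _).obj
    I.cocomplex)).trans ?_
  constructor
  · rintro ⟨y, hy, hd, hw⟩
    exact ⟨y.1, hy, y.2, congrArg Subtype.val hd, fun ⟨w, hwt, h⟩ => hw ⟨⟨w, hwt⟩, Subtype.ext h⟩⟩
  · rintro ⟨y, hy, ht, hd, hw⟩
    exact ⟨⟨y, ht⟩, hy, Subtype.ext hd, fun ⟨w, h⟩ => hw ⟨w.1, w.2, congrArg Subtype.val h⟩⟩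

end Torsion

end GrMod

namespace GrMod

open HomologicalComplex

variable {R : Type u} [CommRing R] {𝒜 : ℕ → AddSubgroup R} {M N : GrMod.{v} 𝒜}

/-! ### Degree shifts and multiplication by a linear form -/

section Shift

/-- The shifted graded module `M(-k)`, whose component of degree `n` is that of `M` in
degree `n - k`. -/
def shift (k : ℤ) (M : GrMod.{v} 𝒜) : GrMod.{v} 𝒜 where
  carrier := M
  deg n := M.deg (n - k)
  isInternal := isInternal_of_proj (fun n => M.proj (n - k))
    (fun n x => gradedProj_mem _ _ _)
    (fun n j x hx hj => gradedProj_ne M.isInternal hx (by omega))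
    (fun x => by
      obtain ⟨s, hs⟩ := exists_sum_gradedProj M.isInternal x
      refine ⟨s.map (Equiv.addRight k).toEmbedding, ?_⟩
      simpa [proj] using hs)
  smul_mem i j r m hr hm := by
    have := M.smul_mem i (j - k) r m hr hm
    rwa [← add_sub_assoc] at this

/-- The shift of a morphism. -/
def shiftMap (k : ℤ) (f : M ⟶ N) : shift k M ⟶ shift k N := ⟨f.lin, fun n => f.map_deg (n - k)⟩

instance (k : ℤ) (f : M ⟶ N) [Mono f] : Mono (shiftMap k f) :=
  mono_of_injective _ (injective_of_mono f)

/-- The shift of a complex. -/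
abbrev shiftComplex (k : ℤ) (K : CochainComplex (GrMod.{v} 𝒜) ℕ) :
    CochainComplex (GrMod.{v} 𝒜) ℕ where
  X n := shift k (K.X n)
  d i j := shiftMap k (K.d i j)
  shape i j hij := hom_ext fun x => lin_apply_of_eq (K.shape i j hij) x
  d_comp_d' i j l _ _ := hom_ext fun x => lin_apply_of_eq (K.d_comp_d i j l) x

/-- Shifting is invertible: a map into `I(-k)` is the same as a map from the oppositely shifted
source into `I`, where injectivity applies. -/
instance (k : ℤ) (I : GrMod.{v} 𝒜) [Injective I] : Injective (shift k I) where
  factors {X Y} g f hf := by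
    have hdeg : ∀ (n : ℤ) (W : GrMod.{v} 𝒜), (shift (-k) W).deg (n - k) = W.deg n := by
      intro n W
      exact congrArg W.deg (by omega)
    have hdeg' : ∀ (n : ℤ) (W : GrMod.{v} 𝒜), (shift k W).deg (n + k) = W.deg n := by
      intro n W
      exact congrArg W.deg (by omega)
    let g' : shift (-k) X ⟶ I := ⟨g.lin, fun n m hm => by
      rw [← hdeg' n I]
      refine g.map_deg (n + k) m ?_
      have h : (shift (-k) X).deg n = X.deg (n + k) := congrArg X.deg (by omega)
      rwa [← h]⟩
    let e := Injective.factorThru g' (shiftMap (-k) f)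
    have he : shiftMap (-k) f ≫ e = g' := Injective.comp_factorThru _ _
    exact ⟨⟨e.lin, fun n m hm => e.map_deg (n - k) m (by rwa [hdeg])⟩,
      hom_ext fun x => lin_apply_of_eq he x⟩

/-- The shift of an injective resolution. -/
noncomputable def shiftResolution (k : ℤ) (I : InjectiveResolution M) :
    InjectiveResolution (shift k M) :=
  .ofExact (shiftComplex k I.cocomplex) (shiftMap k I.aug)
    (hom_ext fun x => lin_apply_of_eq I.aug_d x)
    (exact_of_apply fun x hx => exact_apply I.aug_exact x hx)
    (fun n => (exactAt_iff' _ n (n + 1) (n + 2) (by simp) (by simp)).2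
      (exact_of_apply fun x hx => exact_apply (I.exact_succ n) x hx))

variable {z : R}

/-- Multiplication by `z ∈ R_k` as a morphism `M(-k) ⟶ M`. -/
def mulShift {k : ℕ} (hz : z ∈ 𝒜 k) (M : GrMod.{v} 𝒜) : shift k M ⟶ M where
  lin := (LinearMap.lsmul R M z : M →ₗ[R] M)
  map_deg n m hm := by
    have := M.smul_mem k (n - k) z m hz hm
    rwa [add_sub_cancel] at this

/-- Multiplication by `z` on a complex. -/
def mulShiftComplex {k : ℕ} (hz : z ∈ 𝒜 k) (K : CochainComplex (GrMod.{v} 𝒜) ℕ) :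
    shiftComplex k K ⟶ K where
  f n := mulShift hz (K.X n)
  comm' i j _ := hom_ext fun x => (K.d i j).lin.map_smul z x

/-- Stop just before the least power of `z` that kills `x`; that power is not the zeroth because `x
≠ 0`. -/
lemma exists_pow_smul_ne_zero {x : M} (h0 : x ≠ 0) (hx : ∃ k, z ^ k • x = 0) :
    ∃ k, z ^ k • x ≠ 0 ∧ z • z ^ k • x = 0 := by
  classical
  have h := Nat.find_spec hx
  obtain ⟨k, hk⟩ : ∃ k, Nat.find hx = k + 1 := by
    refine Nat.exists_eq_succ_of_ne_zero fun h' => h0 ?_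
    rw [h'] at h
    simpa using h
  refine ⟨k, Nat.find_min hx (by omega), ?_⟩
  rw [smul_smul, ← pow_succ', ← hk]
  exact h

variable [GradedRing 𝒜]

lemma pow_mem_graded {k : ℕ} (hz : z ∈ 𝒜 k) (n : ℕ) : z ^ n ∈ 𝒜 (n * k) :=
  SetLike.pow_mem_graded n hz

lemma exists_pow_smul_eq_zero (hz : z ∈ 𝒜 1) {x : M} (hx : x ∈ M.torsion) : ∃ k, z ^ k • x = 0 := by
  obtain ⟨t, ht⟩ := hx
  exact ⟨t, ht t le_rfl _ (by simpa using pow_mem_graded hz t)⟩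

variable [Small.{v} R]

lemma localCohomology_shift_deg_ne_bot_iff (k : ℤ) {i : ℕ} {n : ℤ} :
    (localCohomology i (shift k M)).deg n ≠ ⊥ ↔ (localCohomology i M).deg (n - k) ≠ ⊥ := by
  let I := injectiveResolution M
  -- The shifted resolution has the same modules, differentials and torsion; only the degrees are
  -- renamed, so both descriptions agree by definition.
  exact (localCohomology_deg_ne_bot_iff (shiftResolution k I)).trans
    (localCohomology_deg_ne_bot_iff I).symm

/-- If `H^i(M(-1))` is nonzero in degree `n`, then the kernel of the multiplication by a linear form
`H^i(M(-1)) ⟶ H^i(M)` is nonzero in some degree at least `n`. -/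
lemma exists_ker_localCohomology_mulShift (hz : z ∈ 𝒜 1) {i : ℕ} {n : ℤ}
    (h : (localCohomology i (shift (1 : ℕ) M)).deg n ≠ ⊥) :
    ∃ m ≥ n, ∃ x ∈ (localCohomology i (shift (1 : ℕ) M)).deg m, x ≠ 0 ∧
      (localCohomologyMap i (mulShift hz M)).lin x = 0 := by
  let I := injectiveResolution M
  let J := shiftResolution ((1 : ℕ) : ℤ) I
  let φ : J.cocomplex ⟶ I.cocomplex := mulShiftComplex hz I.cocomplex
  have hφ : J.aug ≫ φ.f 0 = mulShift hz M ≫ I.aug := by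
    refine (congrArg (· ≫ φ.f 0) (InjectiveResolution.ofExact_aug _ _ _ _ _)).trans ?_
    exact hom_ext fun x => (I.aug.lin.map_smul z x).symm
  let T := (torsionFunctor.{v} 𝒜).mapHomologicalComplex (ComplexShape.up ℕ)
  let e₁ : localCohomology i (shift (1 : ℕ) M) ≅ (T.obj J.cocomplex).homology i :=
    J.isoRightDerivedObj (torsionFunctor.{v} 𝒜) i
  let e₂ : localCohomology i M ≅ (T.obj I.cocomplex).homology i :=
    I.isoRightDerivedObj (torsionFunctor.{v} 𝒜) i
  have hnat : localCohomologyMap i (mulShift hz M) ≫ e₂.hom =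
      e₁.hom ≫ homologyMap (T.map φ) i :=
    InjectiveResolution.isoRightDerivedObj_hom_naturality _ J I φ hφ _ i
  rw [deg_ne_bot_iff] at h
  obtain ⟨x, hx, hx0⟩ := h
  obtain ⟨y, -, hy⟩ := exists_represents (e₁.hom.map_deg n x hx)
  -- The class is represented by a torsion cochain, which a power of `z` already kills at the level
  -- of cochains; hence the bounding cochain `0`.
  have hpow : ∃ k, z ^ k • x = 0 := by
    obtain ⟨k, hk⟩ := exists_pow_smul_eq_zero hz y.2
    refine ⟨k, iso_injective e₁ ?_⟩
    rw [map_smul, map_zero, (hy.smul (z ^ k)).eq_zero_iff]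
    exact ⟨0, by rw [map_zero]; exact (Subtype.ext hk).symm⟩
  obtain ⟨k, hk, hk'⟩ := exists_pow_smul_ne_zero hx0 hpow
  refine ⟨k + n, by omega, z ^ k • x, ?_, hk, ?_⟩
  · exact GrMod.smul_mem _ k n _ _ (by simpa using pow_mem_graded hz k) hx
  · refine iso_injective e₂ ?_
    have hr := hy.smul (z ^ k)
    rw [map_zero, ← comp_lin_apply, hnat, comp_lin_apply, map_smul,
      (hr.map (T.map φ)).eq_zero_iff]
    have hz0 : z • z ^ k • e₁.hom.lin x = 0 := by
      rw [← map_smul, ← map_smul, hk', map_zero]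
    -- The chain map `φ` is multiplication by `z`, and the two complexes differ only in their
    -- gradings, so the same `w` bounds the image in the unshifted complex.
    obtain ⟨w, hw⟩ := ((hr.smul z).eq_zero_iff).1 hz0
    exact ⟨w, hw⟩

end Shift

end GrMod

/-! ### Power torsion in injective modules over a noetherian ring -/

section PowTorsion

variable {R : Type*} [CommRing R] (I : Ideal R) (J : Type*) [AddCommGroup J] [Module R J]

/-- The submodule of elements killed by a power of the ideal `I`. -/
def powTorsion : Submodule R J where
  carrier := {x | ∃ k : ℕ, ∀ r ∈ I ^ k, r • x = 0}
  zero_mem' := ⟨0, fun _ _ => smul_zero _⟩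
  add_mem' := by
    rintro a b ⟨s, hs⟩ ⟨t, ht⟩
    exact ⟨max s t, fun r hr => by
      rw [smul_add, hs r (Ideal.pow_le_pow_right (le_max_left s t) hr),
        ht r (Ideal.pow_le_pow_right (le_max_right s t) hr), add_zero]⟩
  smul_mem' := by
    rintro c a ⟨s, hs⟩
    exact ⟨s, fun r hr => by rw [smul_comm, hs r hr, smul_zero]⟩

variable {I J}

/-- The maximum of the exponents needed for finitely many generators works for every element. -/
lemma exists_pow_smul_eq_zero_of_fg {A : Type*} [AddCommGroup A] [Module R A] [Module.Finite R A]
    (g : A →ₗ[R] powTorsion I J) : ∃ k : ℕ, ∀ r ∈ I ^ k, ∀ x, r • g x = 0 := by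
  obtain ⟨s, hs⟩ := Module.Finite.fg_top (R := R) (M := A)
  have hk : ∀ x : A, ∃ k : ℕ, ∀ r ∈ I ^ k, r • g x = 0 := fun x => by
    obtain ⟨k, hk⟩ := (g x).2
    exact ⟨k, fun r hr => Subtype.ext (hk r hr)⟩
  choose k hk using hk
  refine ⟨s.sup k, fun r hr x => ?_⟩
  have hx : x ∈ Submodule.span R (s : Set A) := hs ▸ Submodule.mem_top
  induction hx using Submodule.span_induction with
  | mem x hx => exact hk x r (Ideal.pow_le_pow_right (Finset.le_sup hx) hr)
  | zero => simp
  | add x y _ _ hx hy => rw [map_add, smul_add, hx, hy, add_zero]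
  | smul a x _ hx => rw [map_smul, smul_comm, hx, smul_zero]

/-- Over a noetherian ring, the `I`-power torsion of an injective module is injective. -/
lemma powTorsion_baer [IsNoetherianRing R] (hJ : Module.Baer R J) :
    Module.Baer R (powTorsion I J) := by
  intro 𝔞 g
  obtain ⟨k, hk⟩ := exists_pow_smul_eq_zero_of_fg g
  -- Artin–Rees: `I ^ (k + c) ⊓ 𝔞 ≤ I ^ k • 𝔞`, and `g` kills the latter. So `g` factors through the
  -- image of `𝔞` in `R ⧸ I ^ (k + c)`. Extending from there, rather than from `𝔞 ⊆ R`, forces the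
  -- image of `1` to be killed by `I ^ (k + c)`, hence to be torsion.
  obtain ⟨c, hc⟩ := I.exists_pow_inf_eq_pow_smul 𝔞
  have hle : I ^ (k + c) ⊓ 𝔞 ≤ I ^ k • 𝔞 := by
    have := hc (k + c) (by omega)
    rw [smul_eq_mul, Ideal.mul_top, Nat.add_sub_cancel] at this
    rw [this]
    exact Submodule.smul_mono le_rfl inf_le_right
  let q : 𝔞 →ₗ[R] R ⧸ I ^ (k + c) := (Submodule.mkQ (I ^ (k + c))).comp 𝔞.subtype
  have hker : ∀ y ∈ I ^ k • 𝔞, ∀ hy : y ∈ 𝔞, g ⟨y, hy⟩ = 0 := by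
    intro y hy
    induction hy using Submodule.smul_induction_on' with
    | smul r hr n hn =>
      intro hy
      exact (map_smul g r ⟨n, hn⟩).trans (hk r hr _)
    | add x hx y hy ihx ihy =>
      intro hxy
      have h1 : x ∈ 𝔞 := Submodule.smul_le_right hx
      have h2 : y ∈ 𝔞 := Submodule.smul_le_right hy
      refine (map_add g ⟨x, h1⟩ ⟨y, h2⟩).trans ?_
      rw [ihx h1, ihy h2, add_zero]
  have hq : LinearMap.ker q ≤ LinearMap.ker ((powTorsion I J).subtype.comp g) := by
    intro x hx
    have h1 : (x : R) ∈ I ^ (k + c) := (Submodule.Quotient.mk_eq_zero _).1 hx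
    have h2 : g x = 0 := hker x (hle ⟨h1, x.2⟩) x.2
    simp [h2]
  obtain ⟨h, hh⟩ := hJ.extension_property ((LinearMap.ker q).liftQ q le_rfl)
    (LinearMap.ker_eq_bot.1 (Submodule.ker_liftQ_eq_bot _ _ _ le_rfl))
    ((LinearMap.ker q).liftQ ((powTorsion I J).subtype.comp g) hq)
  let f : R →ₗ[R] J := h.comp (Submodule.mkQ (I ^ (k + c)))
  have hf : f 1 ∈ powTorsion I J := by
    refine ⟨k + c, fun r hr => ?_⟩
    rw [← map_smul, smul_eq_mul, mul_one]
    refine (congrArg h ((Submodule.Quotient.mk_eq_zero _).2 hr)).trans (map_zero h)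
  refine ⟨LinearMap.toSpanSingleton R _ ⟨f 1, hf⟩, fun x hx => Subtype.ext ?_⟩
  refine Eq.trans ?_ (LinearMap.congr_fun hh (Submodule.Quotient.mk ⟨x, hx⟩))
  change x • f 1 = f x
  rw [← map_smul, smul_eq_mul, mul_one]

end PowTorsion

namespace GrMod

/-! ### Standard graded rings and the vanishing of higher local cohomology on torsion modules -/

section Standard

variable {R : Type u} [CommRing R] {𝒜 : ℕ → AddSubgroup R} [GradedRing 𝒜]

lemma span_pow_le (k : ℕ) : Ideal.span (𝒜 1 : Set R) ^ k ≤ Ideal.span (𝒜 k : Set R) := by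
  induction k with
  | zero =>
    rw [pow_zero, Ideal.one_eq_top, top_le_iff, Ideal.eq_top_iff_one]
    exact Ideal.subset_span SetLike.GradedOne.one_mem
  | succ k ih =>
    rw [pow_succ]
    refine (Ideal.mul_mono_left ih).trans ?_
    rw [Ideal.span_mul_span']
    refine Ideal.span_mono ?_
    rintro _ ⟨a, ha, b, hb, rfl⟩
    exact SetLike.GradedMul.mul_mem ha hb

/-- The condition that the component of each degree `n` lies in the `n`-th power of `(R_1)` holds
for `R_0` and `R_1` and is stable under sums and products, so it holds on all of `R`. Together with
`span_pow_le` it identifies graded torsion with power torsion for `(R_1)`. -/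
lemma mem_span_pow (hstd : Algebra.adjoin (𝒜 0) (𝒜 1 : Set R) = ⊤) {t : ℕ} {r : R}
    (hr : r ∈ 𝒜 t) : r ∈ Ideal.span (𝒜 1 : Set R) ^ t := by
  have key : ∀ r : R, ∀ n, (DirectSum.decompose 𝒜 r n : R) ∈ Ideal.span (𝒜 1 : Set R) ^ n := by
    intro r
    have hr : r ∈ Algebra.adjoin (𝒜 0) (𝒜 1 : Set R) := hstd ▸ Algebra.mem_top
    induction hr using Algebra.adjoin_induction with
    | mem x hx =>
      intro n
      by_cases hn : 1 = n
      · subst hn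
        rw [DirectSum.decompose_of_mem_same 𝒜 hx, pow_one]
        exact Ideal.subset_span hx
      · rw [DirectSum.decompose_of_mem_ne 𝒜 hx hn]
        exact zero_mem _
    | algebraMap r =>
      intro n
      by_cases hn : 0 = n
      · subst hn
        simp
      · have h : (DirectSum.decompose 𝒜 (r : R) n : R) = 0 :=
          DirectSum.decompose_of_mem_ne 𝒜 (i := 0) r.2 hn
        exact h ▸ zero_mem _
    | add x y _ _ hx hy =>
      intro n
      rw [DirectSum.decompose_add]
      exact add_mem (hx n) (hy n)
    | mul x y _ _ hx hy =>
      intro n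
      rw [DirectSum.decompose_mul, DirectSum.coe_mul_apply_eq_sum_antidiagonal]
      refine sum_mem fun ij hij => ?_
      rw [← Finset.HasAntidiagonal.mem_antidiagonal.1 hij, pow_add]
      exact Ideal.mul_mem_mul (hx _) (hy _)
  have := key r t
  rwa [DirectSum.decompose_of_mem_same 𝒜 hr] at this

variable {M : GrMod.{v} 𝒜}

lemma mem_torsion_iff (hstd : Algebra.adjoin (𝒜 0) (𝒜 1 : Set R) = ⊤) {x : M} :
    x ∈ M.torsion ↔ x ∈ powTorsion (Ideal.span (𝒜 1 : Set R)) M := by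
  constructor
  · rintro ⟨t, ht⟩
    refine ⟨t, fun r hr => ?_⟩
    have : Ideal.span (𝒜 t : Set R) ≤ LinearMap.ker (LinearMap.toSpanSingleton R M x) :=
      Ideal.span_le.2 fun r hr => ht t le_rfl r hr
    exact this (span_pow_le t hr)
  · rintro ⟨k, hk⟩
    exact ⟨k, fun t ht r hr => hk r (Ideal.pow_le_pow_right ht (mem_span_pow hstd hr))⟩

/-- A torsion module embeds into a torsion injective module. -/
lemma exists_torsion_injective [Small.{v} R] [IsNoetherianRing R]
    (hstd : Algebra.adjoin (𝒜 0) (𝒜 1 : Set R) = ⊤)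
    (hM : ∀ x : M, x ∈ M.torsion) : ∃ (E : GrMod.{v} 𝒜) (f : M ⟶ E), Injective E ∧
      Function.Injective f.lin ∧ ∀ x : E, x ∈ E.torsion := by
  let I := (EnoughInjectives.presentation (ModuleCat.of R M)).some
  have := I.injective
  have := I.mono
  let J : ModuleCat R := I.J
  let i : M →ₗ[R] J := I.f.hom
  have hi : Function.Injective i := (ModuleCat.mono_iff_injective I.f).1 inferInstance
  let 𝔪 := Ideal.span (𝒜 1 : Set R)
  have hJ : Module.Baer R J :=
    Module.Baer.of_injective (Module.injective_module_of_injective_object R J)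
  have := (powTorsion_baer (I := 𝔪) hJ).injective
  have hinj := Module.injective_object_of_injective_module R (powTorsion 𝔪 J)
  let J' : ModuleCat R := ModuleCat.of R (powTorsion 𝔪 J)
  let g : M →ₗ[R] J' := i.codRestrict (powTorsion 𝔪 J) fun x => by
    obtain ⟨k, hk⟩ := (mem_torsion_iff hstd).1 (hM x)
    exact ⟨k, fun r hr => by rw [← map_smul, hk r hr, map_zero]⟩
  -- The torsion part `J'` of an ungraded injective module containing `M` is injective; the Laurent
  -- construction turns it into a graded injective module that is still torsion.
  refine ⟨laurent 𝒜 J', toLaurent g, laurent_injective J', fun x y hxy => ?_, fun x => ?_⟩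
  · have := congrArg laurentEval hxy
    rw [laurentEval_toLaurent, laurentEval_toLaurent] at this
    exact hi (congrArg Subtype.val this)
  · induction x using induction_on with
    | zero => exact zero_mem _
    | add x y hx hy => exact add_mem hx hy
    | homog n x hx =>
      obtain ⟨y, rfl⟩ := hx
      obtain ⟨k, hk⟩ := y.2
      refine ⟨k, fun t ht r hr => (smul_mono hr n y).trans ?_⟩
      have : r • y = 0 :=
        Subtype.ext (hk r (Ideal.pow_le_pow_right ht (mem_span_pow hstd hr)))
      rw [this, map_zero]
      rfl

variable [Small.{v} R]

/-- Elementwise form of the long exact sequence of local cohomology. -/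
lemma localCohomology_long_exact {S : ShortComplex (GrMod.{v} 𝒜)} (hS : S.ShortExact) (i : ℕ) :
    (∀ x, (localCohomologyMap i S.g).lin x = 0 ↔ ∃ y, (localCohomologyMap i S.f).lin y = x) ∧
    ∃ δ : localCohomology i S.X₃ ⟶ localCohomology (i + 1) S.X₁,
      (∀ x, δ.lin x = 0 ↔ ∃ y, (localCohomologyMap i S.g).lin y = x) ∧
      (∀ x, (localCohomologyMap (i + 1) S.f).lin x = 0 ↔ ∃ y, δ.lin y = x) := by
  have aux : ∀ {X Y Z : GrMod.{v} 𝒜} {f : X ⟶ Y} {g : Y ⟶ Z} (w : f ≫ g = 0),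
      (ShortComplex.mk f g w).Exact → ∀ x, g.lin x = 0 ↔ ∃ y, f.lin y = x := by
    intro X Y Z f g w h x
    exact ⟨exact_apply h x, fun ⟨y, hy⟩ => hy ▸ lin_apply_of_eq w y⟩
  obtain ⟨⟨w₀, h₀⟩, δ, w₁, w₂, h₁, h₂⟩ :=
    exists_rightDerived_long_exact (torsionFunctor.{v} 𝒜) S hS i
  exact ⟨aux w₀ h₀, δ, aux w₁ h₁, aux w₂ h₂⟩

/-- Every lift of a torsion element along `f` is torsion here, so `f` remains surjective on torsion
parts. This starts the dimension shift below. -/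
lemma localCohomologyMap_zero_surjective {N : GrMod.{v} 𝒜} (f : M ⟶ N)
    (hf : Function.Surjective f.lin) (hM : ∀ x : M, x ∈ M.torsion) :
    Function.Surjective (localCohomologyMap 0 f).lin := by
  intro y
  obtain ⟨x, hx⟩ := hf ((localCohomologyZeroIso N).hom.lin y).1
  have hnat : localCohomologyMap 0 f ≫ (localCohomologyZeroIso N).hom =
      (localCohomologyZeroIso M).hom ≫ (torsionFunctor.{v} 𝒜).map f :=
    (torsionFunctor.{v} 𝒜).rightDerivedZeroIsoSelf.hom.naturality f
  let x' : (torsionFunctor.{v} 𝒜).obj M := ⟨x, hM x⟩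
  refine ⟨(localCohomologyZeroIso M).inv.lin x',
    iso_injective (localCohomologyZeroIso N) ?_⟩
  rw [← comp_lin_apply, hnat, comp_lin_apply, inv_hom_apply]
  exact Subtype.ext hx

/-- Torsion modules have no higher local cohomology. -/
lemma localCohomology_succ_eq_zero [IsNoetherianRing R]
    (hstd : Algebra.adjoin (𝒜 0) (𝒜 1 : Set R) = ⊤) (hM : ∀ x : M, x ∈ M.torsion) (i : ℕ)
    (x : localCohomology (i + 1) M) : x = 0 := by
  induction i generalizing M with
  | zero =>
    -- Since `H^1(E) = 0`, every class in `H^1(M)` is a connecting image from `H^0(E / M)`, and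
    -- these vanish because `H^0(E)` surjects onto `H^0(E / M)`.
    obtain ⟨E, f, _, hf, hE⟩ := exists_torsion_injective hstd hM
    have hS : (ShortComplex.mk f _ (comp_quotπ f)).ShortExact :=
      shortExact_of_apply hf (Submodule.mkQ_surjective _)
        (fun x hx => (Submodule.Quotient.mk_eq_zero _).1 hx)
    obtain ⟨-, δ, h₁, h₂⟩ := localCohomology_long_exact hS 0
    obtain ⟨y, rfl⟩ := (h₂ x).1 (isZero_iff.1
      ((torsionFunctor.{v} 𝒜).isZero_rightDerived_obj_injective_succ 0 E) _)
    exact (h₁ y).2 (localCohomologyMap_zero_surjective _ (Submodule.mkQ_surjective _) hE y)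
  | succ i ih =>
    obtain ⟨E, f, _, hf, hE⟩ := exists_torsion_injective hstd hM
    have hS : (ShortComplex.mk f _ (comp_quotπ f)).ShortExact :=
      shortExact_of_apply hf (Submodule.mkQ_surjective _)
        (fun x hx => (Submodule.Quotient.mk_eq_zero _).1 hx)
    obtain ⟨-, δ, h₁, h₂⟩ := localCohomology_long_exact hS (i + 1)
    obtain ⟨y, rfl⟩ := (h₂ x).1 (isZero_iff.1
      ((torsionFunctor.{v} 𝒜).isZero_rightDerived_obj_injective_succ (i + 1) E) _)
    -- Dimension shift: the quotient of a torsion module is torsion, so the induction hypothesis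
    -- applies to it.
    rw [ih (M := E.quot _ (range_homog f)) (fun q => ?_) y, map_zero]
    obtain ⟨e, rfl⟩ := Submodule.mkQ_surjective _ q
    exact map_torsion (E.quotπ _ (range_homog f)) e (hE e)

end Standard

end GrMod

namespace GrMod

/-! ### Local cohomology modulo a filter-regular linear form -/

section LinearForm

variable {R : Type u} [CommRing R] {𝒜 : ℕ → AddSubgroup R} [GradedRing 𝒜] [Small.{v} R]
  [IsNoetherianRing R] {M C : GrMod.{v} 𝒜} {z : R}

/-- The comparison of the local cohomology of `M` and `M / zM` for a filter-regular linear
form `z`. -/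
lemma localCohomology_cokernel (hstd : Algebra.adjoin (𝒜 0) (𝒜 1 : Set R) = ⊤) (hz : z ∈ 𝒜 1)
    (hM : ∀ n, ∀ x ∈ M.deg n, z • x = 0 → x ∈ M.torsion) (p : M ⟶ C)
    (hp : Function.Surjective p.lin) (hker : ∀ x, p.lin x = 0 ↔ ∃ y : M, z • y = x)
    (i : ℕ) (n : ℤ) :
    ((localCohomology (i + 1) M).deg n ≠ ⊥ → ∃ m ≥ n + 1, (localCohomology i C).deg m ≠ ⊥) ∧
    ((localCohomology i C).deg n ≠ ⊥ →
      (localCohomology i M).deg n ≠ ⊥ ∨ (localCohomology (i + 1) M).deg (n - 1) ≠ ⊥) := by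
  let S := shift ((1 : ℕ) : ℤ) M
  let g : S ⟶ M := mulShift hz M
  let T := S.sub (LinearMap.ker g.lin) (ker_homog g)
  have hT : ∀ x : T, x ∈ T.torsion := by
    intro x
    induction x using induction_on with
    | zero => exact zero_mem _
    | add x y hx hy => exact add_mem hx hy
    | homog n x hx =>
      obtain ⟨t, ht⟩ := hM _ x.1 hx x.2
      exact ⟨t, fun k hk r hr => Subtype.ext (ht k hk r hr)⟩
  let B := M.sub (LinearMap.range g.lin) (range_homog g)
  let q : S ⟶ B := ⟨g.lin.rangeRestrict, g.map_deg⟩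
  let j : B ⟶ M := M.subι _ (range_homog g)
  have hqj : q ≫ j = g := rfl
  have w₁ : S.subι _ (ker_homog g) ≫ q = 0 := hom_ext fun x => Subtype.ext x.2
  have w₂ : j ≫ p = 0 := hom_ext fun x => (hker _).2 x.2
  have h₁ : (ShortComplex.mk _ _ w₁).ShortExact :=
    shortExact_of_apply Subtype.val_injective g.lin.surjective_rangeRestrict
      fun x hx => ⟨⟨x, congrArg Subtype.val hx⟩, rfl⟩
  have h₂ : (ShortComplex.mk _ _ w₂).ShortExact :=
    shortExact_of_apply Subtype.val_injective hp fun x hx => ⟨⟨x, (hker x).1 hx⟩, rfl⟩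
  obtain ⟨hq₀, δ', hq₁, -⟩ := localCohomology_long_exact h₁ (i + 1)
  obtain ⟨-, δ, hp₁, hp₂⟩ := localCohomology_long_exact h₂ i
  have hqinj : ∀ x, (localCohomologyMap (i + 1) q).lin x = 0 → x = 0 := by
    intro x hx
    obtain ⟨y, rfl⟩ := (hq₀ x).1 hx
    rw [localCohomology_succ_eq_zero hstd hT i y, map_zero]
  constructor
  · intro hn
    rw [← add_sub_cancel_right n 1] at hn
    obtain ⟨m, hm, x, hx, hx0, hgx⟩ := exists_ker_localCohomology_mulShift hz
      ((localCohomology_shift_deg_ne_bot_iff ((1 : ℕ) : ℤ)).2 hn)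
    refine ⟨m, hm, ?_⟩
    have hgx' : (localCohomologyMap (i + 1) j).lin ((localCohomologyMap (i + 1) q).lin x) = 0 := by
      rw [← comp_lin_apply, ← localCohomologyMap_comp]
      exact hgx
    obtain ⟨y, hy⟩ := (hp₂ _).1 hgx'
    obtain ⟨y, hym, hy⟩ := exists_mem_deg_of_map δ
      ((localCohomologyMap (i + 1) q).map_deg m x hx) hy
    rw [deg_ne_bot_iff]
    exact ⟨y, hym, fun h0 => hx0 (hqinj x (by rw [← hy, h0, map_zero]))⟩
  · intro hn
    rw [deg_ne_bot_iff] at hn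
    obtain ⟨y, hy, hy0⟩ := hn
    by_cases hδ : δ.lin y = 0
    · left
      obtain ⟨x, hx⟩ := (hp₁ y).1 hδ
      obtain ⟨x, hxn, hx⟩ := exists_mem_deg_of_map (localCohomologyMap i p) hy hx
      rw [deg_ne_bot_iff]
      exact ⟨x, hxn, fun h0 => hy0 (by rw [← hx, h0, map_zero])⟩
    · right
      obtain ⟨x, hx⟩ := (hq₁ (δ.lin y)).1 (localCohomology_succ_eq_zero hstd hT (i + 1) _)
      obtain ⟨x, hxn, hx⟩ := exists_mem_deg_of_map (localCohomologyMap (i + 1) q)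
        (δ.map_deg n y hy) hx
      refine (localCohomology_shift_deg_ne_bot_iff ((1 : ℕ) : ℤ)).1 ?_
      rw [deg_ne_bot_iff]
      exact ⟨x, hxn, fun h0 => hδ (by rw [← hx, h0, map_zero])⟩

end LinearForm

/-! ### The quotients by initial segments of the sequence, and colon submodules -/

section PartialQuot

variable {R : Type u} [CommRing R] {𝒜 : ℕ → AddSubgroup R} (M : GrMod.{v} 𝒜) {s : ℕ}
  {z : Fin s → R}

lemma proj_smul_mem {r : R} (hr : r ∈ 𝒜 1) (n : ℤ) (x : M) :
    M.proj n (r • x) = r • M.proj (n - 1) x := by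
  have h : ((1 : ℕ) : ℤ) + (n - 1) = n := by omega
  rw [smul_proj M hr, h]

lemma partialQuot_homog (hz : ∀ i, z i ∈ 𝒜 1) (i : ℕ) (n : ℤ) (x : M)
    (hx : x ∈ M.partialQuot z i) : M.proj n x ∈ M.partialQuot z i := by
  have key : ∀ r ∈ Ideal.span (z '' {j | (j : ℕ) < i}), ∀ x : M,
      M.proj n (r • x) ∈ M.partialQuot z i := by
    intro r hr
    induction hr using Submodule.span_induction with
    | mem r hr =>
      intro x
      obtain ⟨j, hj, rfl⟩ := id hr
      rw [proj_smul_mem M (hz j)]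
      exact Submodule.smul_mem_smul (Ideal.subset_span hr) Submodule.mem_top
    | zero => intro x; simp
    | add a b _ _ ha hb =>
      intro x
      rw [add_smul, map_add]
      exact add_mem (ha x) (hb x)
    | smul a r _ hr =>
      intro x
      rw [smul_eq_mul, mul_comm, mul_smul]
      exact hr _
  refine Submodule.smul_induction_on hx (fun r hr x _ => key r hr x) fun x y hx hy => ?_
  rw [map_add]
  exact add_mem hx hy

lemma partialQuot_zero : M.partialQuot z 0 = ⊥ := by
  simp [partialQuot]

lemma mem_partialQuot_succ {i : ℕ} (hi : i < s) (x : M) :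
    x ∈ M.partialQuot z (i + 1) ↔ ∃ y, ∃ w ∈ M.partialQuot z i, z ⟨i, hi⟩ • y + w = x := by
  have hset : z '' {j | (j : ℕ) < i + 1} = insert (z ⟨i, hi⟩) (z '' {j | (j : ℕ) < i}) := by
    rw [← Set.image_insert_eq]
    congr 1
    ext j
    simp only [Set.mem_ofPred_eq, Set.mem_insert_iff, Fin.ext_iff]
    omega
  rw [partialQuot, hset, Ideal.span_insert, Submodule.sup_smul, Submodule.mem_sup,
    Submodule.ideal_span_singleton_smul]
  constructor
  · rintro ⟨_, ⟨y, -, rfl⟩, w, hw, rfl⟩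
    exact ⟨y, w, hw, rfl⟩
  · rintro ⟨y, w, hw, rfl⟩
    exact ⟨_, ⟨y, Submodule.mem_top, rfl⟩, w, hw, rfl⟩

/-- The graded module `M / Q_i M`. -/
abbrev quotSeq (hz : ∀ i, z i ∈ 𝒜 1) (i : ℕ) : GrMod.{v} 𝒜 :=
  M.quot (M.partialQuot z i) (M.partialQuot_homog hz i)

variable {M}

lemma mk_eq_zero_iff (hz : ∀ i, z i ∈ 𝒜 1) {i : ℕ} {m : M} :
    (M.quotπ _ (M.partialQuot_homog hz i)).lin m = 0 ↔ m ∈ M.partialQuot z i :=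
  Submodule.Quotient.mk_eq_zero _

/-- The canonical projection `M / Q_i M ⟶ M / Q_{i+1} M`. -/
def quotSeqSucc (hz : ∀ i, z i ∈ 𝒜 1) {i : ℕ} (hi : i < s) :
    M.quotSeq hz i ⟶ M.quotSeq hz (i + 1) where
  lin := Submodule.mapQ _ _ LinearMap.id fun x hx =>
    (M.mem_partialQuot_succ hi x).2 ⟨0, x, hx, by simp⟩
  map_deg := by
    rintro n _ ⟨x, hx, rfl⟩
    exact ⟨x, hx, rfl⟩

lemma quotSeqSucc_surjective (hz : ∀ i, z i ∈ 𝒜 1) {i : ℕ} (hi : i < s) :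
    Function.Surjective (quotSeqSucc (M := M) hz hi).lin := by
  intro x
  obtain ⟨x, rfl⟩ := Submodule.mkQ_surjective _ x
  exact ⟨Submodule.Quotient.mk x, rfl⟩

/-- This holds because `Q_{i+1} M = z_{i+1} M + Q_i M`. It presents `M / Q_{i+1} M` as a cokernel of
`z_{i+1}`, the form required by `localCohomology_cokernel`. -/
lemma quotSeqSucc_eq_zero_iff (hz : ∀ i, z i ∈ 𝒜 1) {i : ℕ} (hi : i < s) (x : M.quotSeq hz i) :
    (quotSeqSucc hz hi).lin x = 0 ↔ ∃ y, z ⟨i, hi⟩ • y = x := by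
  obtain ⟨m, rfl⟩ := Submodule.mkQ_surjective _ x
  refine ((Submodule.Quotient.mk_eq_zero _).trans (M.mem_partialQuot_succ hi m)).trans ?_
  constructor
  · rintro ⟨y, w, hw, rfl⟩
    refine ⟨Submodule.Quotient.mk y, (Submodule.Quotient.eq _).2 ?_⟩
    rw [sub_add_cancel_left]
    exact neg_mem hw
  · rintro ⟨y, hy⟩
    obtain ⟨y, rfl⟩ := Submodule.mkQ_surjective _ y
    refine ⟨y, m - z ⟨i, hi⟩ • y, ?_, by abel⟩
    rw [← neg_sub]
    exact neg_mem ((Submodule.Quotient.eq _).1 hy)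

/-- If `z` kills `x`, it kills each `r • x`. For `r` of large degree this multiple lies where
filter-regularity leaves no kernel, so it is zero. -/
lemma torsion_of_filterRegular (hz : ∀ i, z i ∈ 𝒜 1) (hreg : M.IsFilterRegularSeq z) {i : ℕ}
    (hi : i < s) (n : ℤ) (x : M.quotSeq hz i) (hx : x ∈ (M.quotSeq hz i).deg n)
    (hzx : z ⟨i, hi⟩ • x = 0) : x ∈ (M.quotSeq hz i).torsion := by
  obtain ⟨m, hm, rfl⟩ := hx
  obtain ⟨-, n₀, hn₀⟩ := hreg ⟨i, hi⟩
  have hzm : z ⟨i, hi⟩ • m ∈ M.partialQuot z i := (mk_eq_zero_iff hz).1 hzx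
  refine ⟨(n₀ - n).toNat, fun t ht r hr => (mk_eq_zero_iff hz).2 ?_⟩
  refine hn₀ (t + n) (by omega) (r • m) (M.smul_mem t n r m hr hm) ?_
  rw [smul_comm]
  exact Submodule.smul_mem _ r hzm

lemma exists_colon_quot {K : Submodule R M} {hK : ∀ n, ∀ x ∈ K, M.proj n x ∈ K} {I : Ideal R}
    {m : ℤ} {y : M.quot K hK} (hy : y ∈ (M.quot K hK).deg m) (hy0 : y ≠ 0)
    (h : ∀ r ∈ I, r • y = 0) : ∃ x ∈ M.deg m, x ∈ M.colon K I ∧ x ∉ K := by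
  obtain ⟨x, hx, rfl⟩ := hy
  exact ⟨x, hx, fun r hr => (Submodule.Quotient.mk_eq_zero _).1 (h r hr),
    fun hxK => hy0 ((Submodule.Quotient.mk_eq_zero _).2 hxK)⟩

variable [GradedRing 𝒜]

/-- Take a nonzero multiple `r • x` with `r` in the last degree not annihilating `x`. Multiplying
further by `R_+` enters degrees that do annihilate `x`. Such a degree exists because `1` has degree
0 and `x ≠ 0`. -/
lemma exists_colon_irrelevant_of_torsion {n : ℤ} {x : M} (hx : x ∈ M.deg n) (ht : x ∈ M.torsion)
    (h0 : x ≠ 0) : ∃ m ≥ n, ∃ y ∈ M.deg m, y ≠ 0 ∧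
      ∀ r ∈ (HomogeneousIdeal.irrelevant 𝒜).toIdeal, r • y = 0 := by
  classical
  have hex : ∃ t, ∀ k ≥ t, ∀ r ∈ 𝒜 k, r • x = 0 := ht
  obtain ⟨t, htt⟩ : ∃ t, Nat.find hex = t + 1 := by
    refine Nat.exists_eq_succ_of_ne_zero fun h => h0 ?_
    have := Nat.find_spec hex 0 h.le 1 SetLike.GradedOne.one_mem
    rwa [one_smul] at this
  have hmin := Nat.find_min hex (m := t) (by omega)
  have hspec := Nat.find_spec hex
  rw [htt] at hspec
  push Not at hmin
  obtain ⟨k, hk, r, hr, hrx⟩ := hmin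
  have hkt : k = t := by
    by_contra hne
    exact hrx (hspec k (by omega) r hr)
  subst hkt
  refine ⟨k + n, by omega, r • x, M.smul_mem k n r x hr hx, hrx, fun a ha => ?_⟩
  rw [← DirectSum.sum_support_decompose 𝒜 a, Finset.sum_smul]
  refine Finset.sum_eq_zero fun l _ => ?_
  rcases Nat.eq_zero_or_pos l with rfl | hl
  · have : (DirectSum.decompose 𝒜 a 0 : R) = 0 := ha
    rw [this, zero_smul]
  · rw [smul_smul]
    exact hspec (l + k) (by omega) _ (SetLike.GradedMul.mul_mem (SetLike.coe_mem _) hr)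

lemma mem_torsion_of_irrelevant {y : M}
    (h : ∀ r ∈ (HomogeneousIdeal.irrelevant 𝒜).toIdeal, r • y = 0) : y ∈ M.torsion := by
  refine ⟨1, fun t ht r hr => h r ?_⟩
  change GradedRing.proj 𝒜 0 r = 0
  rw [GradedRing.proj_apply]
  exact DirectSum.decompose_of_mem_ne 𝒜 hr (by omega)

variable [Small.{v} R]

lemma localCohomology_zero_quot_deg_ne_bot {K : Submodule R M}
    {hK : ∀ n, ∀ x ∈ K, M.proj n x ∈ K} {I : Ideal R}
    (hI : ∀ n, ∀ y ∈ (M.quot K hK).deg n, (∀ r ∈ I, r • y = 0) → y ∈ (M.quot K hK).torsion)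
    {n : ℤ} (h : ∃ x ∈ M.deg n, x ∈ M.colon K I ∧ x ∉ K) :
    (localCohomology 0 (M.quot K hK)).deg n ≠ ⊥ := by
  obtain ⟨x, hx, hxI, hxK⟩ := h
  refine localCohomology_zero_deg_ne_bot_iff.2 ⟨(M.quotπ K hK).lin x, ⟨x, hx, rfl⟩,
    hI n _ ⟨x, hx, rfl⟩ fun r hr => ?_, fun h0 => hxK ((Submodule.Quotient.mk_eq_zero _).1 h0)⟩
  exact (Submodule.Quotient.mk_eq_zero _).2 (hxI r hr)

end PartialQuot

end GrMod

/-! ### Comparison of suprema of degrees -/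

section Suprema

/-- Suprema are compared through their upper bounds, which reduces statements about possibly
infinite values to integer inequalities. Moving `j` across the inequality is legitimate because it
is finite. -/
lemma iSup_add_natCast_le_iff {P : ℤ → Prop} {j : ℕ} {b : EReal} :
    (⨆ (n : ℤ) (_ : P n), ((n : ℝ) : EReal)) + (j : EReal) ≤ b ↔
      ∀ n : ℤ, P n → (((n + j : ℤ) : ℝ) : EReal) ≤ b := by
  have hj : ((j : ℕ) : EReal) ≠ ⊥ := EReal.natCast_ne_bot j
  have hj' : ((j : ℕ) : EReal) ≠ ⊤ := EReal.natCast_ne_top j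
  rw [← EReal.le_sub_iff_add_le (.inl hj) (.inl hj')]
  simp only [iSup_le_iff]
  refine forall₂_congr fun n _ => ?_
  rw [EReal.le_sub_iff_add_le (.inl hj) (.inl hj'), ← EReal.coe_coe_eq_natCast, ← EReal.coe_add]
  push_cast
  rfl

lemma iSup_sub_natCast_le_iff {P : ℤ → Prop} {j : ℕ} {b : EReal} :
    (⨆ (n : ℤ) (_ : P n), ((n : ℝ) : EReal)) - (j : EReal) ≤ b ↔
      ∀ n : ℤ, P n → (((n - j : ℤ) : ℝ) : EReal) ≤ b := by
  have hj : ((j : ℕ) : EReal) ≠ ⊥ := EReal.natCast_ne_bot j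
  have hj' : ((j : ℕ) : EReal) ≠ ⊤ := EReal.natCast_ne_top j
  rw [EReal.sub_le_iff_le_add (.inl hj) (.inl hj')]
  simp only [iSup_le_iff]
  refine forall₂_congr fun n _ => ?_
  rw [← EReal.sub_le_iff_le_add (.inl hj) (.inl hj'), ← EReal.coe_coe_eq_natCast,
    ← EReal.coe_sub]
  push_cast
  rfl

variable {D : ℕ → ℕ → ℤ → Prop} {t : ℕ}

/-- Each step trades one cohomological degree for one more element of the sequence and gains at
least 1 in internal degree; `i + j` stays constant, so the bound `t` is respected. -/
lemma exists_ge_of_descent (hD : ∀ i < t, ∀ j n, D i (j + 1) n → ∃ m ≥ n + 1, D (i + 1) j m)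
    (j : ℕ) : ∀ i n, i + j ≤ t → D i j n → ∃ m ≥ n + j, D (i + j) 0 m := by
  induction j with
  | zero => exact fun i n _ h => ⟨n, by simp, h⟩
  | succ j ih =>
    intro i n hij h
    obtain ⟨m, hm, h⟩ := hD i (by omega) j n h
    obtain ⟨l, hl, h⟩ := ih (i + 1) m (by omega) h
    exact ⟨l, by push_cast; omega, by rwa [Nat.add_right_comm] at h⟩

/-- Here `k` counts how often the second alternative occurs: each such step raises the cohomological
degree by 1 and lowers the internal degree by 1. -/
lemma exists_of_ascent
    (hD : ∀ i < t, ∀ j n, D (i + 1) j n → D i j n ∨ D i (j + 1) (n - 1)) (i : ℕ) :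
    ∀ j n, i ≤ t → D i j n → ∃ k ≤ i, D 0 (j + k) (n - k) := by
  induction i with
  | zero => exact fun j n _ h => ⟨0, le_rfl, by simpa using h⟩
  | succ i ih =>
    intro j n hi h
    rcases hD i (by omega) j n h with h | h
    · obtain ⟨k, hk, h⟩ := ih j n (by omega) h
      exact ⟨k, by omega, h⟩
    · obtain ⟨k, hk, h⟩ := ih (j + 1) (n - 1) (by omega) h
      refine ⟨k + 1, by omega, ?_⟩
      rwa [show j + (k + 1) = j + 1 + k by omega,
        show n - ((k + 1 : ℕ) : ℤ) = n - 1 - k by push_cast; ring]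

/-- The suprema attached to a family `D i j` of sets of degrees, linked by the inequalities
coming from long exact sequences, are determined by the sets `D i 0`. -/
lemma iSup_eq_of_descent_ascent {E : ℕ → ℤ → Prop}
    (hdesc : ∀ i < t, ∀ j n, D i (j + 1) n → ∃ m ≥ n + 1, D (i + 1) j m)
    (hasc : ∀ i < t, ∀ j n, D (i + 1) j n → D i j n ∨ D i (j + 1) (n - 1))
    (hED : ∀ i ≤ t, ∀ n, E i n → D i 0 n) (hDE : ∀ i ≤ t, ∀ n, D i 0 n → ∃ m ≥ n, E i m) :
    (⨆ (j : ℕ) (_ : j ≤ t), ((⨆ (n : ℤ) (_ : D 0 j n), ((n : ℝ) : EReal)) + (j : EReal))) =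
        ⨆ (i : ℕ) (_ : i ≤ t), ⨆ (n : ℤ) (_ : E i n), ((n : ℝ) : EReal) ∧
      (⨆ (j : ℕ) (_ : j ≤ t), ⨆ (n : ℤ) (_ : D 0 j n), ((n : ℝ) : EReal)) =
        ⨆ (i : ℕ) (_ : i ≤ t), ((⨆ (n : ℤ) (_ : E i n), ((n : ℝ) : EReal)) - (i : EReal)) := by
  have mono : ∀ {m n : ℤ} {c : EReal}, m ≤ n → ((n : ℝ) : EReal) ≤ c → ((m : ℝ) : EReal) ≤ c :=
    fun h hc => (EReal.coe_le_coe_iff.2 (Int.cast_le.2 h)).trans hc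
  have down : ∀ j ≤ t, ∀ n, D 0 j n → ∃ m ≥ n + j, E j m := by
    intro j hj n h
    obtain ⟨m, hm, h⟩ := exists_ge_of_descent hdesc j 0 n (by omega) h
    rw [Nat.zero_add] at h
    obtain ⟨l, hl, h⟩ := hDE j hj m h
    exact ⟨l, by omega, h⟩
  have up : ∀ i ≤ t, ∀ n, E i n → ∃ k ≤ i, D 0 k (n - k) := by
    intro i hi n h
    simpa using exists_of_ascent hasc i 0 n hi (hED i hi n h)
  constructor
  · refine eq_of_forall_ge_iff fun c => ?_
    simp only [iSup_le_iff, iSup_add_natCast_le_iff]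
    constructor
    · intro h i hi n hE
      obtain ⟨k, hk, hD⟩ := up i hi n hE
      exact mono (by omega) (h k (hk.trans hi) _ hD)
    · intro h j hj n hD
      obtain ⟨m, hm, hE⟩ := down j hj n hD
      exact mono hm (h j hj m hE)
  · refine eq_of_forall_ge_iff fun c => ?_
    simp only [iSup_le_iff, iSup_sub_natCast_le_iff]
    constructor
    · intro h i hi n hE
      obtain ⟨k, hk, hD⟩ := up i hi n hE
      -- Since `k ≤ i`, one has `n - i ≤ n - k`. The same ascent data give the regularity formula
      -- through `n = (n - k) + k`.
      exact mono (by omega) (h k (hk.trans hi) _ hD)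
    · intro h j hj n hD
      obtain ⟨m, hm, hE⟩ := down j hj n hD
      exact mono (by omega) (h j hj m hE)

lemma iSup_fin_succ_eq {f : ℕ → EReal} :
    (⨆ i : Fin (t + 1), f i) = ⨆ (i : ℕ) (_ : i ≤ t), f i := by
  refine eq_of_forall_ge_iff fun c => ?_
  simp only [iSup_le_iff]
  exact ⟨fun h i hi => h ⟨i, by omega⟩, fun h i => h i (by omega)⟩

end Suprema

/-! ### The formulas for the partial regularity and the partial a*-invariant -/

namespace GrMod

variable {R : Type u} [CommRing R] {𝒜 : ℕ → AddSubgroup R} {M : GrMod.{v} 𝒜} {s : ℕ}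
  {z : Fin s → R}

/-- `M` is isomorphic to its quotient by the zero submodule `Q_0 M`. -/
noncomputable def quotSeqZeroIso (hz : ∀ i, z i ∈ 𝒜 1) : M ≅ M.quotSeq hz 0 where
  hom := M.quotπ _ (M.partialQuot_homog hz 0)
  inv :=
    { lin := (Submodule.quotEquivOfEqBot _ M.partialQuot_zero).toLinearMap
      map_deg := by
        rintro n _ ⟨x, hx, rfl⟩
        exact hx }
  hom_inv_id := hom_ext fun _ => rfl
  inv_hom_id := hom_ext fun x => by
    obtain ⟨x, rfl⟩ := Submodule.mkQ_surjective _ x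
    rfl

variable [GradedRing 𝒜]

lemma exists_smul_eq_zero_of_torsion {w : R} (hw : w ∈ 𝒜 1) {n : ℤ} {x : M} (hx : x ∈ M.deg n)
    (ht : x ∈ M.torsion) (h0 : x ≠ 0) :
    ∃ m ≥ n, ∃ y ∈ M.deg m, y ≠ 0 ∧ ∀ r ∈ Ideal.span {w}, r • y = 0 := by
  obtain ⟨k, hk, hk'⟩ := exists_pow_smul_ne_zero h0 (exists_pow_smul_eq_zero hw ht)
  refine ⟨_, ?_, _, M.smul_mem _ n _ x (pow_mem_graded hw k) hx, hk, fun r hr => ?_⟩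
  · omega
  · obtain ⟨a, rfl⟩ := Ideal.mem_span_singleton'.1 hr
    rw [mul_smul, hk', smul_zero]

variable [Small.{v} R] [IsNoetherianRing R]

/-- If for `i ≤ t` the elements of `M / Q_i M` killed by the ideal `I_i` are torsion and occur above
the degree of every torsion element, the top degrees of `(Q_i M : I_i) / Q_i M` determine `reg_t`
and `a*_t`. -/
lemma partialReg_eq_and_partialAStar_eq (hstd : Algebra.adjoin (𝒜 0) (𝒜 1 : Set R) = ⊤)
    (hz : ∀ i, z i ∈ 𝒜 1) (hreg : M.IsFilterRegularSeq z) {t : ℕ} (hts : t ≤ s)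
    (I : ℕ → Ideal R)
    (hI : ∀ i ≤ t, ∀ n, ∀ y ∈ (M.quotSeq hz i).deg n, (∀ r ∈ I i, r • y = 0) →
      y ∈ (M.quotSeq hz i).torsion)
    (hI' : ∀ i ≤ t, ∀ n, ∀ y ∈ (M.quotSeq hz i).deg n, y ∈ (M.quotSeq hz i).torsion → y ≠ 0 →
      ∃ m ≥ n, ∃ x ∈ (M.quotSeq hz i).deg m, x ≠ 0 ∧ ∀ r ∈ I i, r • x = 0) :
    partialReg t M =
        ⨆ (i : ℕ) (_ : i ≤ t), M.topDegreeQuot (M.colon (M.partialQuot z i) (I i))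
          (M.partialQuot z i) ∧
      partialAStar t M =
        ⨆ (i : ℕ) (_ : i ≤ t), (M.topDegreeQuot (M.colon (M.partialQuot z i) (I i))
          (M.partialQuot z i) - (i : EReal)) := by
  -- Replacing `M` by `M / Q_0 M` makes the invariants the row `i = 0` of the family of degrees of
  -- `H^j(M / Q_i M)`.
  have ha : ∀ j, aInv j M = ⨆ (n : ℤ) (_ : (localCohomology j (M.quotSeq hz 0)).deg n ≠ ⊥),
      ((n : ℝ) : EReal) := by
    intro j
    refine iSup_congr fun n => iSup_congr_Prop ?_ fun _ => rfl
    exact deg_ne_bot_iff_of_iso (((torsionFunctor 𝒜).rightDerived j).mapIso (quotSeqZeroIso hz))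
  have hcoker := fun (i : ℕ) (hi : i < t) =>
    localCohomology_cokernel hstd (hz ⟨i, hi.trans_le hts⟩)
      (torsion_of_filterRegular hz hreg (hi.trans_le hts)) (quotSeqSucc hz (hi.trans_le hts))
      (quotSeqSucc_surjective hz _) (quotSeqSucc_eq_zero_iff hz _)
  simp only [partialReg, partialAStar, ha]
  refine iSup_eq_of_descent_ascent
    (D := fun i j n => (localCohomology j (M.quotSeq hz i)).deg n ≠ ⊥)
    (fun i hi j n => (hcoker i hi j n).1) (fun i hi j n => (hcoker i hi j n).2)
    (fun i hi n h => localCohomology_zero_quot_deg_ne_bot (hI i hi) h) fun i hi n h => ?_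
  obtain ⟨y, hy, hyt, hy0⟩ := localCohomology_zero_deg_ne_bot_iff.1 h
  obtain ⟨m, hm, x, hx, hx0, hxI⟩ := hI' i hi n y hy hyt hy0
  exact ⟨m, hm, exists_colon_quot hx hx0 hxI⟩

end GrMod

theorem theorem5p6 {R : Type u} [CommRing R] (𝒜 : ℕ → AddSubgroup R) [GradedRing 𝒜]
    (hR₀ : IsNoetherianRing (𝒜 0)) (hfin : Algebra.FiniteType (𝒜 0) R)
    (hstd : Algebra.adjoin (𝒜 0) (𝒜 1 : Set R) = ⊤)
    (M : GrMod.{max u v} 𝒜) (hM : Module.Finite R M) (t : ℕ) :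
    (∀ z : Fin (t + 1) → R, (∀ i, z i ∈ 𝒜 1) → M.IsFilterRegularSeq z →
      GrMod.partialReg t M = M.aSeq z ∧ GrMod.partialAStar t M = M.sSeq z) ∧
    (∀ z : Fin t → R, (∀ i, z i ∈ 𝒜 1) → M.IsFilterRegularSeq z →
      GrMod.partialReg t M =
        ⨆ (i : ℕ) (_ : i ≤ t), M.topDegreeQuot
          (M.colon (M.partialQuot z i) (HomogeneousIdeal.irrelevant 𝒜).toIdeal)
          (M.partialQuot z i) ∧
      GrMod.partialAStar t M =
        ⨆ (i : ℕ) (_ : i ≤ t), (M.topDegreeQuot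
          (M.colon (M.partialQuot z i) (HomogeneousIdeal.irrelevant 𝒜).toIdeal)
          (M.partialQuot z i) - (i : EReal))) := by
  have : IsNoetherianRing R := Algebra.FiniteType.isNoetherianRing (𝒜 0) R
  refine ⟨fun z hz hreg => ?_, fun z hz hreg => ?_⟩
  -- At step `i` the next form `z_{i+1}` defines the colon, so `i = t` requires `z_{t+1}`. The
  -- default `⊥` concerns only `i > t` and is never reached. With `R_+` as the ideal, the `t` forms
  -- used to pass to quotients suffice.
  · let I : ℕ → Ideal R := fun i => if hi : i < t + 1 then Ideal.span {z ⟨i, hi⟩} else ⊥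
    have hI : ∀ (i : ℕ) (hi : i < t + 1), I i = Ideal.span {z ⟨i, hi⟩} := fun i hi => dif_pos hi
    have h := GrMod.partialReg_eq_and_partialAStar_eq hstd hz hreg (Nat.le_succ t) I
      (fun i hi n y hy h => GrMod.torsion_of_filterRegular hz hreg (by omega) n y hy
        (h _ (by rw [hI i (by omega)]; exact Ideal.mem_span_singleton_self _)))
      (fun i hi n y hy ht h0 => by
        rw [hI i (by omega)]
        exact GrMod.exists_smul_eq_zero_of_torsion (hz _) hy ht h0)
    rw [h.1, h.2, ← iSup_fin_succ_eq, ← iSup_fin_succ_eq]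
    refine ⟨iSup_congr fun i => ?_, iSup_congr fun i => ?_⟩ <;> rw [hI i i.isLt]
  · exact GrMod.partialReg_eq_and_partialAStar_eq hstd hz hreg le_rfl
      (fun _ => (HomogeneousIdeal.irrelevant 𝒜).toIdeal)
      (fun i hi n y hy h => GrMod.mem_torsion_of_irrelevant h)
      (fun i hi n y hy ht h0 => GrMod.exists_colon_irrelevant_of_torsion hy ht h0)
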